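/- **Definitions.** All hypergraphs are finite. An $r$-graph $G$ is a vertex set $V(G)$ with a set of $r$-element subsets of $V(G)$, its edges; $|G|$ is the number of edges. For $S\subseteq V(G)$ with $|S|\le r$, the link $G(S)$ is the $(r-|S|)$-graph on $V(G)\setminus S$ consisting of all $e\subseteq V(G)\setminus S$ such that $S\cup e$ is an edge of $G$. Let $\Delta(G)$ be the maximum of $|G(S)|$ over all $(r-1)$-subsets $S$ of $V(G)$. For non-empty $F$ (i.e. $F$ has at least one edge) and $0\le i\le r-1$, let $\mathrm{Deg}(F)_i:=\gcd\{|F(S)| : S\subseteq V(F),\ |S|=i\}$. An $r$-graph $G$ is *$F$-divisible* if $\mathrm{Deg}(F)_i$ divides $|G(S)|$ for all $0\le i\le r-1$ and all $i$-subsets $S$ of $V(G)$. An *$F$-decomposition* of $G$ is a set $\mathcal F$ of pairwise edge-disjoint copies of $F$ in $G$ which together cover all edges of $G$. It is *$1$-well separated* if $|V(F')\cap V(F'')|\le r$ for all distinct $F',F''\in\mathcal F$ and every $r$-set is contained in $V(F')$ for at most one $F'\in\mathcal F$. Let $\mathcal F^{\le(r+1)}$ be the set of all $(r+1)$-sets that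 are contained in $V(F')$ for some $F'\in\mathcal F$. For an $r$-graph $D$ and a subgraph $D^*\subseteq D$, $D-D^*$ is obtained from $D$ by deleting the edges of $D^*$. **Lemma.** For every $\xi\in(0,1]$ and every $f^*\in\mathbb N$ with $f^*\ge 1$ there is $\gamma_0\in(0,1)$ such that for every $0<\gamma\le\gamma_0$ there is $n_0\in\mathbb N$ such that the following holds for all $n\ge n_0$ and all $r\in\{1,\dots,f^*-1\}$. Let $F$ be a non-empty $r$-graph, and let $F^*$ be a non-empty $r$-graph on $f^*$ vertices which has a $1$-well separated $F$-decomposition. Let $G$ be an $r$-graph on $n$ vertices such that for every set $A$ of $(r-1)$-subsets of $V(G)$ with $|A|\le\binom{f^*-1}{r-1}$ we have $$\Big|\bigcap_{S\in A}G(S)\Big|\ge \xi n$$ (the intersection over $A=\emptyset$ being $V(G)$). Let $O$ be an $(r+1)$-graph on $V(G)$ with $\Delta(O)\le\gamma n$. Then there exists an $F$-divisible subgraph $D\subseteq G$ with $\Delta(D)\le\gamma^{-2}$ such that the following holds: for every $F$-divisible $r$-graph $H$ on $V(G)$ which is edge-disjoint from $D$, there exists a subgraph $D^*\subseteq D$ such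 that $H\cup D^*$ is $F^*$-divisible and $D-D^*$ has a $1$-well separated $F$-decomposition $\mathcal F$ such that $\mathcal F^{\le(r+1)}$ and $O$ are edge-disjoint. -/

import Mathlib

/-- A (finite) `r`-graph: a vertex set together with a set of edges, each of which is a set of
exactly `r` vertices. The vertices live in an ambient type `α`; vertices may be isolated. -/
@[ext]
structure RGraph (r : ℕ) (α : Type*) where
  /-- the vertex set `V(G)` -/
  verts : Finset α
  /-- the edge set -/
  edges : Finset (Finset α)
  subset_verts : ∀ e ∈ edges, e ⊆ verts
  card_eq : ∀ e ∈ edges, e.card = r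

namespace RGraph

/-- The underlying hypergraph in the sense of Mathlib. -/
def toHypergraph {r : ℕ} {α : Type*} (G : RGraph r α) : Hypergraph α where
  vertexSet := (G.verts : Set α)
  edgeSet := (fun e : Finset α => (e : Set α)) '' (G.edges : Set (Finset α))
  subset_vertexSet_of_mem_edgeSet' := by
    rintro _ ⟨e, he, rfl⟩
    exact Finset.coe_subset.2 (G.subset_verts e he)

/-- `D` is a subgraph of `G`. -/
def IsSubgraph {r : ℕ} {α : Type*} (D G : RGraph r α) : Prop :=
  D.verts ⊆ G.verts ∧ D.edges ⊆ G.edges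

/-- The union `G ∪ G'` of two `r`-graphs. -/
def union {r : ℕ} {α : Type*} [DecidableEq α] (G G' : RGraph r α) : RGraph r α where
  verts := G.verts ∪ G'.verts
  edges := G.edges ∪ G'.edges
  subset_verts := by
    intro e he
    rcases Finset.mem_union.1 he with h | h
    · exact (G.subset_verts e h).trans Finset.subset_union_left
    · exact (G'.subset_verts e h).trans Finset.subset_union_right
  card_eq := by
    intro e he
    rcases Finset.mem_union.1 he with h | h
    · exact G.card_eq e h
    · exact G'.card_eq e h

/-- `G - G'`: the `r`-graph on `V(G)` obtained from `G` by deleting all edges of `G'`. -/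
def deleteEdges {r : ℕ} {α : Type*} [DecidableEq α] (G G' : RGraph r α) : RGraph r α where
  verts := G.verts
  edges := G.edges \ G'.edges
  subset_verts := fun e he => G.subset_verts e (Finset.mem_sdiff.1 he).1
  card_eq := fun e he => G.card_eq e (Finset.mem_sdiff.1 he).1

/-- The edge set of the link graph `G(S)`: all subsets of `V(G) \ S` that together with `S` form
an edge of `G`. -/
def link {r : ℕ} {α : Type*} [DecidableEq α] (G : RGraph r α) (S : Finset α) :
    Finset (Finset α) :=
  {e ∈ (G.verts \ S).powerset | S ∪ e ∈ G.edges}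

/-- The maximum `(r-1)`-degree `Δ(G)`: the maximum of `|G(S)|` over all `(r-1)`-subsets `S` of
`V(G)`. -/
def maxDegree {r : ℕ} {α : Type*} [DecidableEq α] (G : RGraph r α) : ℕ :=
  (G.verts.powersetCard (r - 1)).sup fun S => (G.link S).card

/-- For a set `A` of `(r-1)`-subsets of `V(G)`, the common neighbourhood `⋂_{S ∈ A} G(S)`, where
the one-element edges `{v}` of the `1`-graphs `G(S)` are identified with the vertices `v`. The
intersection over the empty family is `V(G)`. -/
def commonNeighbors {r : ℕ} {α : Type*} [DecidableEq α] (G : RGraph r α)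
    (A : Finset (Finset α)) : Finset α :=
  {v ∈ G.verts | ∀ S ∈ A, {v} ∈ G.link S}

/-- The `i`-th entry `Deg(F)_i` of the divisibility vector of `F`: the greatest common divisor of
`|F(S)|` over all `i`-subsets `S` of `V(F)`. -/
def divDegree {r : ℕ} {α : Type*} [DecidableEq α] (F : RGraph r α) (i : ℕ) : ℕ :=
  (F.verts.powersetCard i).gcd fun S => (F.link S).card

/-- `G` is `F`-divisible: `Deg(F)_i` divides `|G(S)|` for all `0 ≤ i ≤ r - 1` and all `i`-subsets
`S` of `V(G)`. -/
def IsDivisible {r : ℕ} {α β : Type*} [DecidableEq α] [DecidableEq β]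
    (F : RGraph r β) (G : RGraph r α) : Prop :=
  ∀ i < r, ∀ S ∈ G.verts.powersetCard i, F.divDegree i ∣ (G.link S).card

/-- `F'` is a copy of `F`, that is, an isomorphic image of `F` (including its vertex set). -/
def IsCopy {r : ℕ} {α β : Type*} [DecidableEq α] (F : RGraph r β) (F' : RGraph r α) : Prop :=
  ∃ φ : β → α, Set.InjOn φ (F.verts : Set β) ∧ F'.verts = F.verts.image φ ∧
    F'.edges = F.edges.image fun e => e.image φ

/-- `𝓕` is an `F`-packing in `G`: a set of pairwise edge-disjoint copies of `F` in `G`. -/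
def IsPacking {r : ℕ} {α β : Type*} [DecidableEq α] (F : RGraph r β) (G : RGraph r α)
    (𝓕 : Finset (RGraph r α)) : Prop :=
  (∀ F' ∈ 𝓕, IsCopy F F' ∧ F'.IsSubgraph G) ∧
    ∀ F₁ ∈ 𝓕, ∀ F₂ ∈ 𝓕, F₁ ≠ F₂ → Disjoint F₁.edges F₂.edges

/-- `𝓕` is an `F`-decomposition of `G`: an `F`-packing in `G` that covers every edge of `G`. -/
def IsDecomposition {r : ℕ} {α β : Type*} [DecidableEq α] (F : RGraph r β) (G : RGraph r α)
    (𝓕 : Finset (RGraph r α)) : Prop :=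
  IsPacking F G 𝓕 ∧ ∀ e ∈ G.edges, ∃ F' ∈ 𝓕, e ∈ F'.edges

/-- `𝓕` is `κ`-well separated: any two distinct members share at most `r` vertices, and every
`r`-set is contained in the vertex set of at most `κ` members. -/
def IsWellSeparated {r : ℕ} {α : Type*} [DecidableEq α] (κ : ℕ) (𝓕 : Finset (RGraph r α)) :
    Prop :=
  (∀ F₁ ∈ 𝓕, ∀ F₂ ∈ 𝓕, F₁ ≠ F₂ → (F₁.verts ∩ F₂.verts).card ≤ r) ∧
    ∀ e : Finset α, e.card = r → {F' ∈ 𝓕 | e ⊆ F'.verts}.card ≤ κ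

/-- `𝓕^{≤(i)}`: the `i`-sets of the complex generated by the vertex sets of the members of `𝓕`,
that is, all `i`-sets contained in `V(F')` for some `F' ∈ 𝓕`. -/
def generatedLevel {r : ℕ} {α : Type*} [DecidableEq α] (𝓕 : Finset (RGraph r α)) (i : ℕ) :
    Finset (Finset α) :=
  𝓕.biUnion fun F' => F'.verts.powersetCard i

end RGraph

/-!
Let `F₀` be a member of the given decomposition of `F*` into copies of `F`. Removing `F₀` from a
copy of `F*` leaves a graph that is decomposed into copies of `F` and whose degrees are, modulo
`Deg(F*)`, the negatives of the degrees of `F₀`. So if the difference of `H` from being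
`F*`-divisible is written as a combination of copies of `F₀`, then it is corrected by adding such
remainders. The graph `D` is a disjoint union of sufficiently many remainders, `D*` is the union
of those that are used, and the others are still decomposed into copies of `F`.

The correction proceeds by the size `k < r` of the sets whose degrees are made divisible. Once all
degrees at sets of fewer than `k` vertices are divisible by the entries of `Deg(F*)`, the degree
function on `k`-sets is, modulo `Deg(F*)_k`, a function whose sum over the supersets of every
smaller set vanishes. Such a function is a combination of octahedra, that is, of signed indicator
functions of the `2 ^ k` transversals of `k` disjoint pairs of vertices, and the octahedra can be
taken from a fixed family such that every `k`-set is a transversal of boundedly many of its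
members (`exists_octahedra`).

A gadget realises a multiple of one octahedron. Fix `k` vertices `s` of `F₀`. For each
transversal, take a copy of `F₀` in which the vertices of `s` are mapped to that transversal and
all other vertices are the same for all transversals, and extend it to copies of `F*` without
`F₀`, in a number that is congruent to minus the sign of the transversal. The degrees at sets of
at most `k` vertices then cancel except at the transversals, where they change by `±|F₀(s)|`
(`divDegree_dvd_degree_gadgetEdges_sub`). Since `Deg(F)_k` is the greatest common divisor of the
`|F₀(s)|`, and all degrees of `H` and of gadgets are divisible by `Deg(F)_k`, the coefficients of
the octahedra are realised by a selection from boundedly many gadgets per octahedron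
(`exists_selection`).

All gadgets are placed in `G` greedily, one vertex after the other (`exists_placement`). The
hypothesis on `G` leaves `ξ n` candidates for each vertex, and only a small proportion of them is
excluded because an edge of `O`, an overlap in `r` vertices with an earlier gadget, or a set that
lies in too many gadgets would arise. Because of the bounded multiplicity of the octahedra, a set
of `r - 1` vertices lies in a bounded number of gadgets, and so `Δ(D)` is bounded independently of
`n` and of `γ`.
-/

open Finset

/-! ### Octahedra -/

/-- The sign `(-1)^{|z|}` of a choice vector `z`. -/
def flipSign {k : ℕ} (z : Fin k → Bool) : ℤ := ∏ i, if z i then -1 else 1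

/-- The transversal `{x₁^{z₁}, …, x_k^{z_k}}` of the vertex pairs `x` selected by `z`. -/
def transversal {k : ℕ} {α : Type*} [DecidableEq α] (x : Fin k → Bool → α) (z : Fin k → Bool) :
    Finset α :=
  univ.image fun i => x i (z i)

/-- The signed indicator function of the transversals of the vertex pairs `x`. -/
def octahedron {k : ℕ} {α : Type*} [DecidableEq α] (x : Fin k → Bool → α) (S : Finset α) : ℤ :=
  ∑ z, if S = transversal x z then flipSign z else 0

lemma flipSign_update {k : ℕ} (z : Fin k → Bool) (i : Fin k) :
    flipSign (Function.update z i (!z i)) = -flipSign z := by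
  unfold flipSign
  rw [← Finset.mul_prod_erase univ _ (mem_univ i), ← Finset.mul_prod_erase univ
    (fun i => if z i then (-1 : ℤ) else 1) (mem_univ i)]
  have : ∏ x ∈ univ.erase i, (if Function.update z i (!z i) x = true then (-1 : ℤ) else 1)
      = ∏ x ∈ univ.erase i, if z x = true then (-1 : ℤ) else 1 := by
    refine prod_congr rfl fun j hj => ?_
    rw [Function.update_of_ne (ne_of_mem_erase hj)]
  rw [this]
  cases h : z i <;> simp

lemma flipSign_eq {k : ℕ} (z : Fin k → Bool) : flipSign z = 1 ∨ flipSign z = -1 := by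
  unfold flipSign
  refine Finset.prod_induction _ (fun a : ℤ => a = 1 ∨ a = -1) ?_ (Or.inl rfl) ?_
  · rintro a b (rfl | rfl) (rfl | rfl) <;> simp
  · intro i _
    split_ifs <;> simp

/-- Choice vectors cancel in pairs in a signed sum that ignores one coordinate. -/
lemma sum_flipSign_mul_eq_zero {k : ℕ} (i : Fin k) (h : (Fin k → Bool) → ℤ)
    (hh : ∀ z, h (Function.update z i (!z i)) = h z) : ∑ z, flipSign z * h z = 0 := by
  refine Finset.sum_involution (fun z _ => Function.update z i (!z i)) ?_ ?_ ?_ ?_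
  · intro z _
    rw [hh, flipSign_update]; ring
  · intro z _ _ h
    have := congrFun h i
    simp at this
  · simp
  · intro z _
    simp

section
variable {k : ℕ} {α : Type*} [DecidableEq α] {x : Fin k → Bool → α}

lemma card_transversal (hx : Function.Injective fun p : Fin k × Bool => x p.1 p.2)
    (z : Fin k → Bool) : (transversal x z).card = k := by
  unfold transversal
  rw [card_image_of_injective, card_univ, Fintype.card_fin]
  intro i j h
  exact congrArg Prod.fst (@hx (i, z i) (j, z j) h)

lemma mem_transversal_iff (hx : Function.Injective fun p : Fin k × Bool => x p.1 p.2)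
    (z : Fin k → Bool) (i : Fin k) (b : Bool) : x i b ∈ transversal x z ↔ z i = b := by
  unfold transversal
  simp only [mem_image, mem_univ, true_and]
  constructor
  · rintro ⟨j, h⟩
    have := @hx (j, z j) (i, b) h
    simp only [Prod.mk.injEq] at this
    obtain ⟨rfl, rfl⟩ := this; rfl
  · rintro rfl; exact ⟨i, rfl⟩

lemma transversal_injective (hx : Function.Injective fun p : Fin k × Bool => x p.1 p.2) :
    Function.Injective (transversal x) := by
  intro z z' h
  funext i
  have := (mem_transversal_iff hx z i (z i)).2 rfl
  rw [h, mem_transversal_iff hx] at this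
  exact this.symm

lemma octahedron_transversal (hx : Function.Injective fun p : Fin k × Bool => x p.1 p.2)
    (z : Fin k → Bool) : octahedron x (transversal x z) = flipSign z := by
  unfold octahedron
  simp [(transversal_injective hx).eq_iff]

lemma octahedron_eq_zero {S : Finset α} (h : ∀ z, S ≠ transversal x z) : octahedron x S = 0 := by
  unfold octahedron
  simp [h]

/-- Octahedra have vanishing degree at every set `T` of fewer than `k` vertices: `T` misses some
pair, and flipping the choice in this pair changes the sign. -/
lemma sum_octahedron_superset (hx : Function.Injective fun p : Fin k × Bool => x p.1 p.2)
    {V : Finset α} (hV : ∀ i b, x i b ∈ V) {T : Finset α} (hT : T.card < k) :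
    ∑ S ∈ V.powersetCard k with T ⊆ S, octahedron x S = 0 := by
  have h1 : ∑ S ∈ V.powersetCard k with T ⊆ S, octahedron x S =
      ∑ z, flipSign z * if T ⊆ transversal x z then 1 else 0 := by
    unfold octahedron
    rw [sum_comm]
    refine sum_congr rfl fun z _ => ?_
    rw [sum_ite_eq']
    simp only [mem_filter, mem_powersetCard, card_transversal hx, and_true, mul_ite, mul_one,
      mul_zero]
    have : transversal x z ⊆ V := by
      intro v hv
      simp only [transversal, mem_image] at hv
      obtain ⟨i, _, rfl⟩ := hv
      exact hV _ _
    simp [this]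
  rw [h1]
  obtain ⟨i, hi⟩ : ∃ i, ∀ b, x i b ∉ T := by
    by_contra! h
    choose z hz using h
    have : transversal x z ⊆ T := by
      intro v hv
      simp only [transversal, mem_image] at hv
      obtain ⟨i, _, rfl⟩ := hv
      exact hz i
    have := card_le_card this
    rw [card_transversal hx] at this
    omega
  refine sum_flipSign_mul_eq_zero i _ fun z => ?_
  have key : ∀ z : Fin k → Bool, ∀ b, T ⊆ transversal x z →
      T ⊆ transversal x (Function.update z i b) := by
    intro z b h v hv
    have := h hv
    simp only [transversal, mem_image, mem_univ, true_and] at this ⊢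
    obtain ⟨j, rfl⟩ := this
    refine ⟨j, ?_⟩
    rw [Function.update_of_ne]
    rintro rfl
    exact hi _ hv
  congr 1
  refine propext ⟨fun h => ?_, key z _⟩
  have := key _ (z i) h
  simpa using this

end

/-- A function on the `k`-subsets of a set of fewer than `2 * k` points vanishes if its sum over
the supersets of every smaller set vanishes. For the proof, the sums are combined by
inclusion–exclusion over the subsets `T` of `S`; only `S` itself survives, since no other `k`-set of
the ground set is disjoint from `S`. -/
lemma eq_zero_of_superset_sums_eq_zero {α A : Type*} [DecidableEq α] [AddCommGroup A] {k : ℕ}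
    {V : Finset α} (hV : V.card < 2 * k) (f : Finset α → A)
    (hf : ∀ T ⊆ V, T.card < k → ∑ S ∈ V.powersetCard k with T ⊆ S, f S = 0)
    {S : Finset α} (hS : S ∈ V.powersetCard k) : f S = 0 := by
  obtain ⟨hSV, hSk⟩ := mem_powersetCard.1 hS
  -- the alternating sum of the superset sums is evaluated in two ways
  have h1 : ∑ T ∈ S.powerset, (-1 : ℤ) ^ T.card • ∑ S' ∈ V.powersetCard k with T ⊆ S', f S' =
      (-1 : ℤ) ^ k • f S := by
    rw [sum_eq_single_of_mem S (mem_powerset_self S)]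
    · rw [hSk]
      congr 1
      rw [sum_eq_single_of_mem S (by simp [hSV, hSk])]
      intro S' hS' hne
      simp only [mem_filter, mem_powersetCard] at hS'
      exact absurd (eq_of_subset_of_card_le hS'.2 (by omega)).symm hne
    · intro T hT hne
      rw [mem_powerset] at hT
      rw [hf T (hT.trans hSV), smul_zero]
      rw [← hSk]
      exact card_lt_card (hT.ssubset_of_ne hne)
  have h2 : ∑ T ∈ S.powerset, (-1 : ℤ) ^ T.card • ∑ S' ∈ V.powersetCard k with T ⊆ S', f S' =
      ∑ S' ∈ V.powersetCard k, (∑ T ∈ (S ∩ S').powerset, (-1 : ℤ) ^ T.card) • f S' := by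
    simp only [smul_sum, sum_smul, sum_filter]
    rw [sum_comm]
    refine sum_congr rfl fun S' _ => ?_
    simp only [smul_ite, smul_zero]
    rw [← sum_filter]
    refine sum_congr ?_ fun _ _ => rfl
    ext T
    simp only [mem_filter, mem_powerset, subset_inter_iff]
  have h3 : ∑ S' ∈ V.powersetCard k, (∑ T ∈ (S ∩ S').powerset, (-1 : ℤ) ^ T.card) • f S' = 0 := by
    refine sum_eq_zero fun S' hS' => ?_
    obtain ⟨hS'V, hS'k⟩ := mem_powersetCard.1 hS'
    rw [sum_powerset_neg_one_pow_card, if_neg, zero_smul]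
    intro h
    have h4 := card_union_of_disjoint (disjoint_iff_inter_eq_empty.2 h)
    have h5 := card_le_card (union_subset hSV hS'V)
    omega
  rw [h1] at h2
  rw [h3] at h2
  rcases neg_one_pow_eq_or ℤ k with h | h <;> rw [h] at h2 <;> simpa using h2

/-! ### Spanning families of octahedra with bounded multiplicity -/

section
variable {k : ℕ} {α : Type*} [DecidableEq α]

lemma transversal_cons (p : Bool → α) (y : Fin k → Bool → α) (z : Fin (k + 1) → Bool) :
    transversal (Fin.cons p y : Fin (k + 1) → Bool → α) z =
      insert (p (z 0)) (transversal y (Fin.tail z)) := by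
  ext v
  simp only [transversal, mem_image, mem_univ, true_and, mem_insert, Fin.exists_fin_succ,
    Fin.cons_zero, Fin.cons_succ, Fin.tail]
  simp only [eq_comm]

/-- The link of the vertex `p false` in the suspension of `y` at the pair `p` is the octahedron of
`y`. -/
lemma octahedron_cons_insert {p : Bool → α} {y : Fin k → Bool → α}
    (hx : Function.Injective
      fun q : Fin (k + 1) × Bool => (Fin.cons p y : Fin (k + 1) → Bool → α) q.1 q.2)
    {T : Finset α} (hT : p false ∉ T) :
    octahedron (Fin.cons p y : Fin (k + 1) → Bool → α) (insert (p false) T) = octahedron y T := by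
  have hy : Function.Injective fun q : Fin k × Bool => y q.1 q.2 := by
    intro q q' h
    have := @hx (q.1.succ, q.2) (q'.1.succ, q'.2) (by simpa using h)
    simpa [Prod.ext_iff] using this
  have hroot : ∀ z, p false ∉ transversal y z := by
    intro z hz
    simp only [transversal, mem_image, mem_univ, true_and] at hz
    obtain ⟨i, hi⟩ := hz
    have := @hx (i.succ, z i) (0, false) (by simpa using hi)
    simp at this
  by_cases h : ∃ z, T = transversal y z
  · obtain ⟨z, rfl⟩ := h
    have h1 : insert (p false) (transversal y z) =
        transversal (Fin.cons p y : Fin (k + 1) → Bool → α) (Fin.cons false z) := by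
      rw [transversal_cons]; simp
    rw [h1, octahedron_transversal hx, octahedron_transversal hy]
    simp [flipSign, Fin.prod_univ_succ]
  · push Not at h
    rw [octahedron_eq_zero h, octahedron_eq_zero]
    intro z hz
    rw [transversal_cons] at hz
    cases h0 : z 0 with
    | false =>
      rw [h0] at hz
      refine h (Fin.tail z) ?_
      rw [← erase_insert hT, hz, erase_insert (hroot _)]
    | true =>
      rw [h0] at hz
      have : p false ∈ insert (p true) (transversal y (Fin.tail z)) := hz ▸ mem_insert_self _ _
      rcases mem_insert.1 this with h1 | h1
      · have := @hx (0, false) (0, true) (by simpa using h1)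
        simp at this
      · exact hroot _ h1

end

/-- Signed octahedra span all functions on `k`-sets with vanishing degrees at smaller sets, and
they can be chosen so that every `k`-set lies in boundedly many of them. The family is built
recursively: to clear the `k + 1`-sets with least vertex `a`, the octahedra of the link of `a` are
suspended at the pair `{a, w}`, where `w` is the first available vertex after `a`. As `w` is within
`2 * k + 1` of `a`, it determines `a` up to a bounded number of choices. -/
lemma exists_octahedra_Ico (k : ℕ) : ∃ C : ℕ, ∀ n a : ℕ, ∃ Q : Finset (Fin k → Bool → ℕ),
    (∀ x ∈ Q, (Function.Injective fun p : Fin k × Bool => x p.1 p.2) ∧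
      ∀ i b, a ≤ x i b ∧ x i b < n) ∧
    (∀ S, #{x ∈ Q | ∃ z, S = transversal x z} ≤ C) ∧
    ∀ {A : Type} [AddCommGroup A] (f : Finset ℕ → A),
      (∀ T ⊆ Ico a n, T.card < k → ∑ S ∈ (Ico a n).powersetCard k with T ⊆ S, f S = 0) →
      ∃ c : (Fin k → Bool → ℕ) → A, ∀ S ∈ (Ico a n).powersetCard k,
        f S = ∑ x ∈ Q, octahedron x S • c x := by
  induction k with
  | zero =>
    refine ⟨1, fun n a => ⟨univ, ?_, ?_, ?_⟩⟩
    · intro x _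
      exact ⟨Function.injective_of_subsingleton _, fun i => i.elim0⟩
    · intro S
      exact (card_filter_le _ _).trans (by simp)
    · intro A _ f _
      refine ⟨fun _ => f ∅, fun S hS => ?_⟩
      simp only [powersetCard_zero, mem_singleton] at hS
      subst hS
      simp [octahedron, transversal, flipSign]
  | succ k ih =>
    obtain ⟨C, hC⟩ := ih
    refine ⟨(k + 1) * (2 * k + 2) * ((k + 1) * C), fun n => ?_⟩
    choose Q hQ1 hQ2 hQ3 using hC n
    have hw : ∀ (a : ℕ) (y : Fin k → Bool → ℕ), ∃ w, a < w ∧ w ≤ a + (2 * k + 1) ∧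
        ∀ i b, y i b ≠ w := by
      intro a y
      have h1 : (univ.image fun p : Fin k × Bool => y p.1 p.2).card <
          (Ioc a (a + (2 * k + 1))).card := by
        refine card_image_le.trans_lt ?_
        simp [Nat.card_Ioc]; omega
      obtain ⟨w, hw, hw'⟩ := exists_mem_notMem_of_card_lt_card h1
      rw [mem_Ioc] at hw
      refine ⟨w, hw.1, hw.2, fun i b h => hw' ?_⟩
      exact mem_image.2 ⟨(i, b), mem_univ _, h⟩
    choose w hw1 hw2 hw3 using hw
    let P : ℕ → (Fin k → Bool → ℕ) → Bool → ℕ := fun a y b => if b then w a y else a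
    let E : ℕ → (Fin k → Bool → ℕ) → Fin (k + 1) → Bool → ℕ := fun a y => Fin.cons (P a y) y
    have hE0 : ∀ a y, E a y 0 false = a := fun a y => by simp [E, P]
    have hEt : ∀ a y, Fin.tail (E a y) = y := fun a y => by simp [E]
    have hEinj : ∀ a, Function.Injective (E a) := fun a y y' h => by
      rw [← hEt a y, h, hEt]
    have hE : ∀ a, a + (2 * k + 1) < n → ∀ y ∈ Q (a + 1),
        (Function.Injective fun p : Fin (k + 1) × Bool => E a y p.1 p.2) ∧
        ∀ i b, a ≤ E a y i b ∧ E a y i b < n := by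
      intro a ha y hy
      obtain ⟨h1, h2⟩ := hQ1 _ y hy
      have h3 := hw1 a y
      have h4 := hw2 a y
      have h5 := hw3 a y
      constructor
      · rintro ⟨i, b⟩ ⟨j, c⟩ h
        induction i using Fin.cases with
        | zero =>
          induction j using Fin.cases with
          | zero =>
            simp only [E, P, Fin.cons_zero] at h
            cases b <;> cases c <;> simp at h ⊢ <;> omega
          | succ j =>
            have h6 := (h2 j c).1
            have h7 := h5 j c
            simp only [E, P, Fin.cons_zero, Fin.cons_succ] at h
            cases b <;> simp at h <;> omega
        | succ i =>
          induction j using Fin.cases with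
          | zero =>
            have h6 := (h2 i b).1
            have h7 := h5 i b
            simp only [E, P, Fin.cons_zero, Fin.cons_succ] at h
            cases c <;> simp at h <;> omega
          | succ j =>
            have := @h1 (i, b) (j, c) (by simpa [E] using h)
            simpa [Prod.ext_iff] using this
      · intro i b
        induction i using Fin.cases with
        | zero =>
          simp only [E, P, Fin.cons_zero]
          cases b <;> simp <;> omega
        | succ i =>
          have := h2 i b
          simp only [E, Fin.cons_succ]
          omega
    let Fam : ℕ → Finset (Fin (k + 1) → Bool → ℕ) := fun a =>
      (Ico a (n - (2 * k + 1))).biUnion fun a' => (Q (a' + 1)).image (E a')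
    have hFam : ∀ a x, x ∈ Fam a ↔ ∃ a', a ≤ a' ∧ a' + (2 * k + 1) < n ∧
        ∃ y ∈ Q (a' + 1), E a' y = x := by
      intro a x
      simp only [Fam, mem_biUnion, mem_Ico, mem_image]
      refine exists_congr fun a' => ?_
      have : a' < n - (2 * k + 1) ↔ a' + (2 * k + 1) < n := by omega
      rw [this, and_assoc]
    refine fun a => ⟨Fam a, ?_, ?_, ?_⟩
    · intro x hx
      obtain ⟨a', ha, ha', y, hy, rfl⟩ := (hFam a x).1 hx
      obtain ⟨h1, h2⟩ := hE a' ha' y hy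
      exact ⟨h1, fun i b => ⟨ha.trans (h2 i b).1, (h2 i b).2⟩⟩
    · intro S
      by_cases hS : S.card = k + 1
      swap
      · rw [card_eq_zero.2]
        · exact Nat.zero_le _
        · refine filter_eq_empty_iff.2 fun x hx => ?_
          obtain ⟨a', ha, ha', y, hy, rfl⟩ := (hFam a x).1 hx
          rintro ⟨z, rfl⟩
          exact hS (card_transversal (hE a' ha' y hy).1 z)
      -- the possible least vertices `a'` of an octahedron with transversal `S`
      let Z : Finset ℕ := S.biUnion fun s => Icc (s - (2 * k + 1)) s
      have hZ : Z.card ≤ (k + 1) * (2 * k + 2) := by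
        rw [← hS]
        refine card_biUnion_le_card_mul _ _ _ fun s _ => ?_
        simp only [Nat.card_Icc]; omega
      have hsub : {x ∈ Fam a | ∃ z, S = transversal x z} ⊆
          Z.biUnion fun a' => S.biUnion fun s =>
            {y ∈ Q (a' + 1) | ∃ z, S.erase s = transversal y z}.image (E a') := by
        intro x hx
        rw [mem_filter] at hx
        obtain ⟨hx, z, hz⟩ := hx
        obtain ⟨a', ha, ha', y, hy, rfl⟩ := (hFam a x).1 hx
        have h3 := hw1 a' y
        have h4 := hw2 a' y
        have htr : S = insert (P a' y (z 0)) (transversal y (Fin.tail z)) := by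
          rw [hz]; exact transversal_cons _ _ _
        have hPS : P a' y (z 0) ∈ S := htr ▸ mem_insert_self _ _
        have hP : a' ≤ P a' y (z 0) ∧ P a' y (z 0) ≤ a' + (2 * k + 1) := by
          simp only [P]; split_ifs <;> omega
        have hPT : P a' y (z 0) ∉ transversal y (Fin.tail z) := by
          intro h
          rw [insert_eq_of_mem h] at htr
          rw [htr, card_transversal (hQ1 _ y hy).1] at hS
          omega
        simp only [mem_biUnion, mem_image, mem_filter]
        refine ⟨a', mem_biUnion.2 ⟨_, hPS, ?_⟩, _, hPS, y, ⟨hy, Fin.tail z, ?_⟩, rfl⟩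
        · rw [mem_Icc]; omega
        · conv_lhs => rw [htr]
          exact erase_insert hPT
      refine (card_le_card hsub).trans ?_
      refine (card_biUnion_le_card_mul _ _ ((k + 1) * C) fun a' _ => ?_).trans
        (Nat.mul_le_mul_right _ hZ)
      exact (card_biUnion_le_card_mul _ _ _ fun s _ => card_image_le.trans (hQ2 _ _)).trans_eq
        (by rw [hS])
    · intro A _
      obtain ⟨d, hd⟩ : ∃ d, n - a = d := ⟨_, rfl⟩
      induction d generalizing a with
      | zero =>
        intro f _
        refine ⟨0, fun S hS => ?_⟩
        rw [Ico_eq_empty (by omega), powersetCard_eq_empty.2 (by simp)] at hS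
        simp at hS
      | succ d ihd =>
        intro f hf
        by_cases han : a + (2 * k + 1) < n
        swap
        · -- at most `2 * k + 1` points are left, so `f` is zero
          refine ⟨0, fun S hS => ?_⟩
          rw [eq_zero_of_superset_sums_eq_zero (k := k + 1) (by rw [Nat.card_Ico]; omega) f hf hS]
          simp
        have hIco : Ico a n = insert a (Ico (a + 1) n) :=
          (insert_Ico_add_one_left_eq_Ico (by omega)).symm
        have hanot : ∀ {T : Finset ℕ}, T ⊆ Ico (a + 1) n → a ∉ T := by
          intro T hT h
          have := mem_Ico.1 (hT h)
          omega
        -- the link of `a` satisfies the degree conditions one level down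
        obtain ⟨c₁, hc₁⟩ := hQ3 (a + 1) (fun T => f (insert a T)) (by
          intro T hT hTk
          rw [← hf (insert a T) (by rw [hIco]; exact insert_subset_insert _ hT)
            (by rw [card_insert_of_notMem (hanot hT)]; omega)]
          refine sum_nbij' (insert a) (fun S => S.erase a) ?_ ?_ ?_ ?_ ?_
          · intro S hS
            simp only [mem_filter, mem_powersetCard] at hS ⊢
            refine ⟨⟨by rw [hIco]; exact insert_subset_insert _ hS.1.1, ?_⟩,
              insert_subset_insert _ hS.2⟩
            rw [card_insert_of_notMem (hanot hS.1.1), hS.1.2]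
          · intro S hS
            simp only [mem_filter, mem_powersetCard] at hS ⊢
            have haS : a ∈ S := hS.2 (mem_insert_self _ _)
            refine ⟨⟨?_, by rw [card_erase_of_mem haS, hS.1.2]; rfl⟩, ?_⟩
            · rw [← erase_insert (hanot (Subset.refl (Ico (a + 1) n))), ← hIco]
              exact erase_subset_erase _ hS.1.1
            · rw [← erase_insert (hanot hT)]
              exact erase_subset_erase _ hS.2
          · intro S hS
            simp only [mem_filter, mem_powersetCard] at hS
            exact erase_insert (hanot hS.1.1)
          · intro S hS
            simp only [mem_filter, mem_powersetCard] at hS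
            exact insert_erase (hS.2 (mem_insert_self _ _))
          · intros; rfl)
        -- `f'` vanishes on the sets that contain `a`, so it is a function on `Ico (a + 1) n`
        let f' : Finset ℕ → A := fun S => f S - ∑ y ∈ Q (a + 1), octahedron (E a y) S • c₁ y
        have hf'a : ∀ T ∈ (Ico (a + 1) n).powersetCard k, f' (insert a T) = 0 := by
          intro T hT
          simp only [f', sub_eq_zero]
          rw [hc₁ T hT]
          refine sum_congr rfl fun y hy => ?_
          congr 1
          have h1 := (hE a han y hy).1
          have h2 : P a y false = a := by simp [P]
          have := octahedron_cons_insert (p := P a y) (y := y) h1 (T := T)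
            (by rw [h2]; exact hanot (mem_powersetCard.1 hT).1)
          rw [h2] at this
          exact this.symm
        have hf' : ∀ T ⊆ Ico a n, T.card < k + 1 →
            ∑ S ∈ (Ico a n).powersetCard (k + 1) with T ⊆ S, f' S = 0 := by
          intro T hT hTk
          simp only [f', sum_sub_distrib]
          rw [hf T hT hTk, sum_comm, zero_sub, neg_eq_zero]
          refine sum_eq_zero fun y hy => ?_
          rw [← sum_smul]
          obtain ⟨h1, h2⟩ := hE a han y hy
          rw [sum_octahedron_superset h1 (fun i b => mem_Ico.2 (h2 i b)) hTk, zero_smul]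
        obtain ⟨c₂, hc₂⟩ := ihd (a + 1) (by omega) f' (by
          intro T hT hTk
          rw [← hf' T (hT.trans (by rw [hIco]; exact subset_insert _ _)) hTk]
          refine sum_subset ?_ ?_
          · refine filter_subset_filter _ (powersetCard_mono ?_)
            rw [hIco]; exact subset_insert _ _
          · intro S hS hS'
            simp only [mem_filter, mem_powersetCard, not_and] at hS hS'
            have haS : a ∈ S := by
              by_contra haS
              refine hS' ⟨?_, hS.1.2⟩ hS.2
              rw [← subset_insert_iff_of_notMem haS, ← hIco]
              exact hS.1.1
            rw [← insert_erase haS]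
            refine hf'a _ (mem_powersetCard.2 ⟨?_, by rw [card_erase_of_mem haS, hS.1.2]; rfl⟩)
            rw [← erase_insert (hanot (Subset.refl (Ico (a + 1) n))), ← hIco]
            exact erase_subset_erase _ hS.1.1)
        refine ⟨fun x => if x 0 false = a then c₁ (Fin.tail x) else c₂ x, fun S hS => ?_⟩
        have hsplit : Fam a = (Q (a + 1)).image (E a) ∪ Fam (a + 1) := by
          simp only [Fam]
          rw [← insert_Ico_add_one_left_eq_Ico (a := a) (by omega), biUnion_insert]
        have hne : ∀ x ∈ Fam (a + 1), x 0 false ≠ a := by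
          intro x hx
          obtain ⟨a', ha, ha', y, hy, rfl⟩ := (hFam _ x).1 hx
          rw [hE0]; omega
        have hdisj : Disjoint ((Q (a + 1)).image (E a)) (Fam (a + 1)) := by
          rw [disjoint_left]
          intro x hx hx'
          obtain ⟨y, _, rfl⟩ := mem_image.1 hx
          exact hne _ hx' (hE0 a y)
        rw [hsplit, sum_union hdisj, sum_image fun _ _ _ _ h => hEinj a h]
        simp only [hE0, hEt, if_true]
        rw [sum_congr (s₁ := Fam (a + 1)) rfl (fun x hx => by rw [if_neg (hne x hx)])]
        rw [← sub_eq_iff_eq_add']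
        by_cases haS : a ∈ S
        · obtain ⟨hS1, hS2⟩ := mem_powersetCard.1 hS
          have h0 : f' S = 0 := by
            rw [← insert_erase haS]
            refine hf'a _ (mem_powersetCard.2 ⟨?_, by rw [card_erase_of_mem haS, hS2]; rfl⟩)
            rw [← erase_insert (hanot (Subset.refl (Ico (a + 1) n))), ← hIco]
            exact erase_subset_erase _ hS1
          refine Eq.trans h0 (sum_eq_zero fun x hx => ?_).symm
          obtain ⟨a', ha, ha', y, hy, rfl⟩ := (hFam _ x).1 hx
          rw [octahedron_eq_zero, zero_smul]
          rintro z rfl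
          simp only [transversal, mem_image, mem_univ, true_and] at haS
          obtain ⟨i, hi⟩ := haS
          have := ((hE a' ha' y hy).2 i (z i)).1
          omega
        · refine hc₂ S (mem_powersetCard.2 ⟨?_, (mem_powersetCard.1 hS).2⟩)
          rw [← subset_insert_iff_of_notMem haS, ← hIco]
          exact (mem_powersetCard.1 hS).1

/-- The spanning family of octahedra on an arbitrary finite vertex set, by transport along an
enumeration. The bound `C` does not depend on the vertex set. -/
lemma exists_octahedra (k : ℕ) : ∃ C : ℕ, ∀ {α : Type*} [DecidableEq α] (V : Finset α),
    ∃ Q : Finset (Fin k → Bool → α),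
    (∀ x ∈ Q, (Function.Injective fun p : Fin k × Bool => x p.1 p.2) ∧ ∀ i b, x i b ∈ V) ∧
    (∀ S, #{x ∈ Q | ∃ z, S = transversal x z} ≤ C) ∧
    ∀ {A : Type} [AddCommGroup A] (f : Finset α → A),
      (∀ T ⊆ V, T.card < k → ∑ S ∈ V.powersetCard k with T ⊆ S, f S = 0) →
      ∃ c : (Fin k → Bool → α) → A, ∀ S ∈ V.powersetCard k,
        f S = ∑ x ∈ Q, octahedron x S • c x := by
  obtain ⟨C, hC⟩ := exists_octahedra_Ico k
  refine ⟨C + 1, fun {α} _ V => ?_⟩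
  rcases Nat.eq_zero_or_pos k with rfl | hk
  · refine ⟨univ, ?_, ?_, ?_⟩
    · intro x _
      exact ⟨Function.injective_of_subsingleton _, fun i => i.elim0⟩
    · intro S
      exact (card_filter_le _ _).trans (by simp)
    · intro A _ f _
      refine ⟨fun _ => f ∅, fun S hS => ?_⟩
      simp only [powersetCard_zero, mem_singleton] at hS
      subst hS
      simp [octahedron, transversal, flipSign]
  rcases V.eq_empty_or_nonempty with rfl | ⟨v₀, hv₀⟩
  · refine ⟨∅, by simp, by simp, fun f _ => ⟨0, fun S hS => ?_⟩⟩
    rw [powersetCard_eq_empty.2 (by simpa using hk)] at hS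
    simp at hS
  obtain ⟨Q, hQ1, hQ2, hQ3⟩ := hC V.card 0
  let pos : α → ℕ := fun v => if h : v ∈ V then V.equivFin ⟨v, h⟩ else 0
  let φ : ℕ → α := fun i => if h : i < V.card then V.equivFin.symm ⟨i, h⟩ else v₀
  have hφV : ∀ i, φ i ∈ V := fun i => by
    simp only [φ]; split_ifs
    · exact Subtype.prop _
    · exact hv₀
  have hpos : ∀ v, pos v ∈ Ico 0 V.card := fun v => by
    simp only [pos]; split_ifs
    · simp
    · simpa using ⟨v₀, hv₀⟩
  have hφpos : ∀ v ∈ V, φ (pos v) = v := fun v hv => by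
    simp [φ, pos, hv]
  have hposφ : ∀ i ∈ Ico 0 V.card, pos (φ i) = i := fun i hi => by
    have hi' := (mem_Ico.1 hi).2
    have : φ i = V.equivFin.symm ⟨i, hi'⟩ := by simp [φ, hi']
    simp only [pos, hφV, dif_pos]
    simp [this]
  have hinj : Set.InjOn φ (Ico 0 V.card : Finset ℕ) := fun i hi j hj h => by
    rw [← hposφ i hi, h, hposφ j hj]
  have hinj' : Set.InjOn pos V := fun i hi j hj h => by
    rw [← hφpos i hi, h, hφpos j hj]
  have him : ∀ S ⊆ V, (S.image pos).image φ = S := fun S hS => by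
    rw [image_image]
    conv_rhs => rw [← image_id (s := S)]
    exact image_congr fun v hv => hφpos v (hS hv)
  have him' : ∀ S ⊆ Ico 0 V.card, (S.image φ).image pos = S := fun S hS => by
    rw [image_image]
    conv_rhs => rw [← image_id (s := S)]
    exact image_congr fun v hv => hposφ v (hS hv)
  have hsub : ∀ S : Finset α, S.image pos ⊆ Ico 0 V.card := fun S =>
    image_subset_iff.2 fun v _ => hpos v
  have hsub' : ∀ S : Finset ℕ, S.image φ ⊆ V := fun S =>
    image_subset_iff.2 fun v _ => hφV v
  let F : (Fin k → Bool → ℕ) → Fin k → Bool → α := fun x i b => φ (x i b)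
  have htr : ∀ (x : Fin k → Bool → ℕ) z, transversal (F x) z = (transversal x z).image φ := by
    intro x z
    simp only [transversal, image_image, F]; rfl
  have hxI : ∀ x ∈ Q, ∀ i b, x i b ∈ Ico 0 V.card := fun x hx i b => mem_Ico.2 ((hQ1 x hx).2 i b)
  have htrI : ∀ x ∈ Q, ∀ z, transversal x z ⊆ Ico 0 V.card := fun x hx z =>
    image_subset_iff.2 fun i _ => hxI x hx _ _
  have hFinj : Set.InjOn F Q := by
    intro x hx y hy h
    funext i b
    exact hinj (hxI x hx i b) (hxI y hy i b) (congrFun (congrFun h i) b)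
  have htr_iff : ∀ x ∈ Q, ∀ S ⊆ V, ∀ z, S = transversal (F x) z ↔
      S.image pos = transversal x z := by
    intro x hx S hS z
    rw [htr]
    constructor
    · rintro rfl; exact him' _ (htrI x hx z)
    · intro h; rw [← h, him S hS]
  refine ⟨Q.image F, ?_, ?_, ?_⟩
  · intro x hx
    obtain ⟨y, hy, rfl⟩ := mem_image.1 hx
    refine ⟨fun p q h => (hQ1 y hy).1 (hinj (hxI y hy _ _) (hxI y hy _ _) h), fun i b => hφV _⟩
  · intro S
    refine le_trans ?_ ((hQ2 (S.image pos)).trans (Nat.le_succ C))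
    rw [filter_image]
    refine card_image_le.trans (card_le_card fun x hx => ?_)
    rw [mem_filter] at hx ⊢
    obtain ⟨hx, z, hz⟩ := hx
    refine ⟨hx, z, (htr_iff x hx S ?_ z).1 hz⟩
    rw [hz, htr]; exact hsub' _
  · intro A _ f hf
    obtain ⟨c, hc⟩ := hQ3 (fun S => f (S.image φ)) (by
      intro T hT hTk
      rw [← hf (T.image φ) (hsub' T) (card_image_le.trans_lt hTk)]
      refine sum_nbij' (image φ) (image pos) ?_ ?_ ?_ ?_ ?_
      · intro S hS
        simp only [mem_filter, mem_powersetCard] at hS ⊢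
        refine ⟨⟨hsub' _, ?_⟩, image_subset_image hS.2⟩
        rw [card_image_of_injOn (hinj.mono (coe_subset.2 hS.1.1)), hS.1.2]
      · intro S hS
        simp only [mem_filter, mem_powersetCard] at hS ⊢
        refine ⟨⟨hsub _, ?_⟩, ?_⟩
        · rw [card_image_of_injOn (hinj'.mono (coe_subset.2 hS.1.1)), hS.1.2]
        · rw [← him' T hT]; exact image_subset_image hS.2
      · intro S hS
        simp only [mem_filter, mem_powersetCard] at hS
        exact him' S hS.1.1
      · intro S hS
        simp only [mem_filter, mem_powersetCard] at hS
        exact him S hS.1.1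
      · intros; rfl)
    refine ⟨fun x => c fun i b => pos (x i b), fun S hS => ?_⟩
    obtain ⟨hSV, hSk⟩ := mem_powersetCard.1 hS
    have h1 := hc (S.image pos) (mem_powersetCard.2 ⟨hsub S, by
      rw [card_image_of_injOn (hinj'.mono (coe_subset.2 hSV)), hSk]⟩)
    rw [him S hSV] at h1
    rw [h1, sum_image hFinj]
    refine sum_congr rfl fun x hx => ?_
    have h2 : (fun i b => pos (F x i b)) = x := by
      funext i b; exact hposφ _ (hxI x hx i b)
    simp only [h2]
    congr 1
    unfold octahedron
    exact sum_congr rfl fun z _ => by simp only [htr_iff x hx S hSV z]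

/-! ### Greedy placement -/

/-- The set of the first `i` values of a sequence of vertices. -/
def placed {α : Type*} [DecidableEq α] (u : ℕ → α) (i : ℕ) : Finset α := (range i).image u

/-- The faces of the complex whose facets are `B ∪ U`, for `B ∈ 𝓑`. -/
abbrev IsFace {α : Type*} [DecidableEq α] (𝓑 : Finset (Finset α)) (U S : Finset α) : Prop :=
  ∃ B ∈ 𝓑, S ⊆ B ∪ U

lemma IsFace.mono {α : Type*} [DecidableEq α] {𝓑 : Finset (Finset α)} {U S T : Finset α}
    (h : IsFace 𝓑 U S) (hT : T ⊆ S) : IsFace 𝓑 U T :=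
  let ⟨B, hB, hS⟩ := h
  ⟨B, hB, hT.trans hS⟩

/-- A sequence is built entry by entry, if the condition on entry `i` depends on the entries up
to `i` only. -/
lemma exists_seq_of_step {α : Type*} (P : ℕ → (ℕ → α) → Prop)
    (hloc : ∀ i u u', (∀ j ≤ i, u j = u' j) → P i u → P i u') (u₀ : ℕ → α) (s : ℕ)
    (h : ∀ i < s, ∀ u, (∀ j < i, P j u) → ∃ v, P i (Function.update u i v)) :
    ∃ u, ∀ i < s, P i u := by
  induction s with
  | zero => exact ⟨u₀, by simp⟩
  | succ s ih =>
    obtain ⟨u, hu⟩ := ih fun i hi => h i (by omega)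
    obtain ⟨v, hv⟩ := h s (by omega) u hu
    refine ⟨Function.update u s v, fun i hi => ?_⟩
    rcases Nat.lt_succ_iff_lt_or_eq.1 hi with hi | rfl
    · refine hloc i u _ (fun j hj => ?_) (hu i hi)
      rw [Function.update_of_ne (by omega)]
    · exact hv

section
variable {α : Type*} [DecidableEq α]

lemma mem_placed {u : ℕ → α} {i : ℕ} {v : α} : v ∈ placed u i ↔ ∃ j < i, u j = v := by
  simp [placed]

lemma card_placed_le (u : ℕ → α) (i : ℕ) : (placed u i).card ≤ i :=
  card_image_le.trans (by simp)

lemma placed_congr {u u' : ℕ → α} {i : ℕ} (h : ∀ j < i, u j = u' j) : placed u i = placed u' i :=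
  image_congr fun j hj => h j (by simpa using hj)

/-- Every face that is not contained in `B` has a last vertex in the placement order. -/
lemma exists_last_placed {u : ℕ → α} {s : ℕ} {B S : Finset α} (hS : S ⊆ B ∪ placed u s)
    (hB : ¬ S ⊆ B) : ∃ i < s, u i ∈ S ∧ S.erase (u i) ⊆ B ∪ placed u i := by
  have hne : ((range s).filter fun i => u i ∈ S).Nonempty := by
    obtain ⟨v, hv, hvB⟩ := not_subset.1 hB
    obtain ⟨j, hj, rfl⟩ := mem_placed.1 ((mem_union.1 (hS hv)).resolve_left hvB)
    exact ⟨j, by simp [hj, hv]⟩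
  have hmem := max'_mem _ hne
  have hle := le_max' ((range s).filter fun i => u i ∈ S)
  set i := max' _ hne
  simp only [mem_filter, mem_range] at hmem hle
  refine ⟨i, hmem.1, hmem.2, fun v hv => ?_⟩
  obtain ⟨hne', hv⟩ := mem_erase.1 hv
  rcases mem_union.1 (hS hv) with h | h
  · exact mem_union_left _ h
  · obtain ⟨j, hj, rfl⟩ := mem_placed.1 h
    refine mem_union_right _ (mem_placed.2 ⟨j, ?_, rfl⟩)
    have := hle j ⟨hj, hv⟩
    rcases this.lt_or_eq with h | h
    · exact h
    · exact absurd (by rw [h]) hne'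

/-- The vertices of a single request can be chosen one after the other from large candidate sets,
outside the sets `bad T` for all sets `T` of earlier vertices. -/
lemma exists_placement_step (R : Finset α) (s N : ℕ) (cand : ℕ → (ℕ → α) → Finset α)
    (bad : Finset α → Finset α) (m b : ℝ) (hRs : R.card + s ≤ N)
    (hloc : ∀ i u u', (∀ j < i, u j = u' j) → cand i u = cand i u')
    (hcand : ∀ i u, m ≤ (cand i u).card) (hbad : ∀ T, ((bad T).card : ℝ) ≤ b)
    (hm : (N : ℝ) + 2 ^ N * b < m) (u₀ : ℕ → α) :
    ∃ u : ℕ → α, ∀ i < s, u i ∈ cand i u ∧ u i ∉ R ∪ placed u i ∧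
      ∀ T ⊆ R ∪ placed u i, u i ∉ bad T := by
  refine exists_seq_of_step (fun i u => u i ∈ cand i u ∧ u i ∉ R ∪ placed u i ∧
      ∀ T ⊆ R ∪ placed u i, u i ∉ bad T) ?_ u₀ s ?_
  · intro i u u' h hP
    rw [hloc i u u' fun j hj => h j hj.le, placed_congr (u' := u') fun j hj => h j hj.le,
      h i le_rfl] at hP
    exact hP
  · intro i hi u _
    have hb0 : 0 ≤ b := (Nat.cast_nonneg _).trans (hbad ∅)
    have hcard : (R ∪ placed u i).card ≤ N := by
      have h1 := card_union_le R (placed u i)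
      have h2 := card_placed_le u i
      omega
    let Z := (R ∪ placed u i) ∪ (R ∪ placed u i).powerset.biUnion bad
    have hZ : (Z.card : ℝ) ≤ N + 2 ^ N * b := by
      have h1 : (Z.card : ℝ) ≤ (R ∪ placed u i).card +
          ∑ T ∈ (R ∪ placed u i).powerset, ((bad T).card : ℝ) := by
        have := (card_union_le (R ∪ placed u i) ((R ∪ placed u i).powerset.biUnion bad)).trans
          (Nat.add_le_add_left card_biUnion_le _)
        exact_mod_cast this
      refine h1.trans (add_le_add (by exact_mod_cast hcard) ?_)
      refine (sum_le_card_nsmul _ _ b fun T _ => hbad T).trans ?_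
      rw [card_powerset, nsmul_eq_mul]
      push_cast
      gcongr
      norm_num
    obtain ⟨v, hv, hvZ⟩ := exists_mem_notMem_of_card_lt_card (s := Z) (t := cand i u) (by
      have := hZ.trans_lt (hm.trans_le (hcand i u))
      exact_mod_cast this)
    simp only [Z, mem_union, mem_biUnion, mem_powerset, not_or, not_exists, not_and] at hvZ
    refine ⟨v, ?_⟩
    have h1 : ∀ j < i, Function.update u i v j = u j := fun j hj => by
      rw [Function.update_of_ne (by omega)]
    rw [hloc _ _ u h1, placed_congr h1, Function.update_self]
    refine ⟨hv, by simpa using hvZ.1, fun T hT => hvZ.2 T hT⟩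

/-- Greedy placement. Each request `t` consists of root sets `𝓑 t` of fewer than `r` vertices and of
candidate sets for `s` further vertices. If no set is contained in root sets of too many requests,
then the vertices can be chosen such that the faces of the requests avoid `O`, the faces of distinct
requests overlap in fewer than `r` vertices, and every set of `r - 1` vertices is a face of a
bounded number of requests.

The number of requests that gain a set `S` as a new face is kept below
`C₀ * lam ^ |S| * n ^ (r - 1 - |S|)`; since this threshold grows by the factor `lam` with each
vertex, only few vertices would extend a given face to a saturated one. -/
theorem exists_placement {ι : Type*} (V : Finset α) (r s N C₀ lam : ℕ)
    (m γ : ℝ) (I : Finset ι) (𝓑 : ι → Finset (Finset α))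
    (cand : ι → ℕ → (ℕ → α) → Finset α) (O : Finset (Finset α)) (hr : 1 ≤ r) (hC₀ : 1 ≤ C₀)
    (hlam : 1 ≤ lam) (hV : V.Nonempty) (hγ : 0 ≤ γ)
    (h𝓑V : ∀ t ∈ I, ∀ B ∈ 𝓑 t, B ⊆ V) (h𝓑r : ∀ t ∈ I, ∀ B ∈ 𝓑 t, B.card + 1 ≤ r)
    (hN : ∀ t ∈ I, ((𝓑 t).sup id).card + s ≤ N)
    (hloc : ∀ t ∈ I, ∀ i u u', (∀ j < i, u j = u' j) → cand t i u = cand t i u')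
    (hcandV : ∀ t ∈ I, ∀ i u, cand t i u ⊆ V)
    (hcand : ∀ t ∈ I, ∀ i u, m ≤ (cand t i u).card)
    (hO : ∀ T ⊆ V, T.card = r → (#{v ∈ V | insert v T ∈ O} : ℝ) ≤ γ)
    (hroot : ∀ S : Finset α, S.card + 1 ≤ r →
      #{t ∈ I | ∃ B ∈ 𝓑 t, S ⊆ B} ≤ C₀ * V.card ^ (r - 1 - S.card))
    (hm : (N : ℝ) + 2 ^ N * (2 * N * V.card / lam + γ + 2 * N * C₀ * lam ^ r) < m) :
    ∃ u : ι → ℕ → α,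
      (∀ t ∈ I, (∀ i < s, u t i ∈ cand t i (u t) ∧ u t i ∉ (𝓑 t).sup id ∪ placed (u t) i) ∧
        ∀ S, IsFace (𝓑 t) (placed (u t) s) S → S.card = r + 1 → S ∉ O) ∧
      (∀ t ∈ I, ∀ t' ∈ I, t ≠ t' → ∀ S, IsFace (𝓑 t) (placed (u t) s) S →
        IsFace (𝓑 t') (placed (u t') s) S → S.card + 1 ≤ r) ∧
      ∀ S : Finset α, S.card + 1 = r →
        #{t ∈ I | IsFace (𝓑 t) (placed (u t) s) S} ≤ 2 * C₀ * lam ^ r := by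
  classical
  obtain ⟨v₀, hv₀⟩ := hV
  have hn : 1 ≤ V.card := card_pos.2 ⟨v₀, hv₀⟩
  -- the number of requests in `J` of which `S` is a face, but not contained in a root set
  let cF : Finset ι → (ι → ℕ → α) → Finset α → ℕ := fun J u S =>
    #{t ∈ J | IsFace (𝓑 t) (placed (u t) s) S ∧ ¬ ∃ B ∈ 𝓑 t, S ⊆ B}
  have htotal : ∀ J ⊆ I, ∀ u S, S.card + 1 ≤ r →
      cF J u S ≤ C₀ * lam ^ S.card * V.card ^ (r - 1 - S.card) →
      #{t ∈ J | IsFace (𝓑 t) (placed (u t) s) S} ≤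
        2 * C₀ * lam ^ S.card * V.card ^ (r - 1 - S.card) := by
    intro J hJ u S hS hc
    have h1 : ({t ∈ J | IsFace (𝓑 t) (placed (u t) s) S} : Finset ι) ⊆
        {t ∈ I | ∃ B ∈ 𝓑 t, S ⊆ B} ∪
          {t ∈ J | IsFace (𝓑 t) (placed (u t) s) S ∧ ¬ ∃ B ∈ 𝓑 t, S ⊆ B} := by
      intro t ht
      simp only [mem_filter, mem_union] at ht ⊢
      by_cases h : ∃ B ∈ 𝓑 t, S ⊆ B
      · exact Or.inl ⟨hJ ht.1, h⟩
      · exact Or.inr ⟨ht.1, ht.2, h⟩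
    have h2 := (card_le_card h1).trans (card_union_le _ _)
    have h3 := hroot S hS
    have h4 : C₀ * V.card ^ (r - 1 - S.card) ≤
        C₀ * lam ^ S.card * V.card ^ (r - 1 - S.card) :=
      Nat.mul_le_mul_right _ (Nat.le_mul_of_pos_right _ (Nat.pow_pos (by omega)))
    have h5 : 2 * C₀ * lam ^ S.card * V.card ^ (r - 1 - S.card) =
      C₀ * lam ^ S.card * V.card ^ (r - 1 - S.card) +
        C₀ * lam ^ S.card * V.card ^ (r - 1 - S.card) := by ring
    rw [h5]
    exact h2.trans (add_le_add (h3.trans h4) hc)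
  suffices H : ∀ J ⊆ I, ∃ u : ι → ℕ → α,
      (∀ t ∈ J, (∀ i < s, u t i ∈ cand t i (u t) ∧ u t i ∉ (𝓑 t).sup id ∪ placed (u t) i) ∧
        ∀ S, IsFace (𝓑 t) (placed (u t) s) S → S.card = r + 1 → S ∉ O) ∧
      (∀ t ∈ J, ∀ t' ∈ J, t ≠ t' → ∀ S, IsFace (𝓑 t) (placed (u t) s) S →
        IsFace (𝓑 t') (placed (u t') s) S → S.card + 1 ≤ r) ∧
      ∀ S : Finset α, S.card + 1 ≤ r →
        cF J u S ≤ C₀ * lam ^ S.card * V.card ^ (r - 1 - S.card) by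
    obtain ⟨u, h1, h2, h3⟩ := H I (Subset.refl _)
    refine ⟨u, h1, h2, fun S hS => ?_⟩
    refine (htotal I (Subset.refl _) u S (by omega) (h3 S (by omega))).trans ?_
    rw [show r - 1 - S.card = 0 by omega, pow_zero, mul_one]
    exact Nat.mul_le_mul_left _ (Nat.pow_le_pow_right (by omega) (by omega))
  intro J
  induction J using Finset.induction_on with
  | empty => exact fun _ => ⟨fun _ _ => v₀, by simp, by simp, by simp [cF]⟩
  | insert t J htJ ih =>
    intro hJ
    have htI : t ∈ I := hJ (mem_insert_self _ _)
    have hJI : J ⊆ I := (subset_insert _ _).trans hJ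
    obtain ⟨u, h1, h2, h3⟩ := ih hJI
    let X : ι → Finset α := fun t => (𝓑 t).sup id ∪ placed (u t) s
    have hX : ∀ t' ∈ J, (X t').card ≤ N := fun t' ht' => by
      refine (card_union_le _ _).trans ((Nat.add_le_add_left (card_placed_le _ _) _).trans ?_)
      exact hN t' (hJI ht')
    have hXface : ∀ t' S, IsFace (𝓑 t') (placed (u t') s) S → S ⊆ X t' := by
      rintro t' S ⟨B, hB, hS⟩
      exact hS.trans (union_subset_union_left (le_sup (f := id) hB))
    -- the vertices that must not be added to a face `T`: the result would be saturated, or an edge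
    -- of `O`, or an `r`-set that may be a face of an earlier request
    let bad1 : Finset α → Finset α := fun T => {v ∈ V | v ∉ T ∧ T.card + 2 ≤ r ∧
      C₀ * lam ^ (T.card + 1) * V.card ^ (r - 2 - T.card) ≤ cF J u (insert v T)}
    let bad2 : Finset α → Finset α := fun T => {v ∈ V | T ⊆ V ∧ T.card = r ∧ insert v T ∈ O}
    let bad3 : Finset α → Finset α := fun T =>
      if T.card + 1 = r then {t' ∈ J | IsFace (𝓑 t') (placed (u t') s) T}.biUnion X else ∅
    have hbad1 : ∀ T, ((bad1 T).card : ℝ) ≤ 2 * N * V.card / lam := by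
      intro T
      by_cases hT : T.card + 2 ≤ r
      swap
      · have : bad1 T = ∅ := filter_eq_empty_iff.2 fun v _ h => hT h.2.1
        rw [this]; simp; positivity
      have e1 : (bad1 T).card * (C₀ * lam ^ (T.card + 1) * V.card ^ (r - 2 - T.card)) ≤
          ∑ v ∈ bad1 T, cF J u (insert v T) := by
        rw [← smul_eq_mul]
        exact card_nsmul_le_sum _ _ _ fun v hv => (mem_filter.1 hv).2.2.2
      have e2 : ∑ v ∈ bad1 T, cF J u (insert v T) ≤
          ∑ t' ∈ J, if IsFace (𝓑 t') (placed (u t') s) T then N else 0 := by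
        simp only [cF, card_filter]
        rw [sum_comm]
        refine sum_le_sum fun t' ht' => ?_
        rw [← card_filter]
        split_ifs with hf
        · refine (card_le_card fun v hv => ?_).trans (hX t' ht')
          exact hXface t' _ (mem_filter.1 hv).2.1 (mem_insert_self _ _)
        · rw [Nat.le_zero, card_eq_zero, filter_eq_empty_iff]
          exact fun v _ h => hf (h.1.mono (subset_insert _ _))
      have e3 : (∑ t' ∈ J, if IsFace (𝓑 t') (placed (u t') s) T then N else 0) ≤
          (2 * C₀ * lam ^ T.card * V.card ^ (r - 1 - T.card)) * N := by
        rw [← sum_filter, sum_const, smul_eq_mul]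
        exact Nat.mul_le_mul_right _ (htotal J hJI u T (by omega) (h3 T (by omega)))
      have e4 := e1.trans (e2.trans e3)
      rw [show r - 1 - T.card = (r - 2 - T.card) + 1 by omega, pow_succ, pow_succ] at e4
      have e5 : (bad1 T).card * lam ≤ 2 * N * V.card := by
        refine le_of_mul_le_mul_left (a := C₀ * lam ^ T.card * V.card ^ (r - 2 - T.card)) ?_
          (by positivity)
        calc _ = (bad1 T).card * (C₀ * (lam ^ T.card * lam) * V.card ^ (r - 2 - T.card)) := by ring
          _ ≤ _ := e4
          _ = _ := by ring
      rw [le_div_iff₀ (by positivity)]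
      exact_mod_cast e5
    have hbad2 : ∀ T, ((bad2 T).card : ℝ) ≤ γ := by
      intro T
      by_cases hT : T ⊆ V ∧ T.card = r
      · refine le_trans ?_ (hO T hT.1 hT.2)
        exact_mod_cast card_le_card fun v hv => by
          simp only [bad2, mem_filter] at hv ⊢
          exact ⟨hv.1, hv.2.2.2⟩
      · have : bad2 T = ∅ := filter_eq_empty_iff.2 fun v _ h => hT ⟨h.1, h.2.1⟩
        rw [this]; simpa using hγ
    have hbad3 : ∀ T, ((bad3 T).card : ℝ) ≤ 2 * N * C₀ * lam ^ r := by
      intro T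
      simp only [bad3]
      split_ifs with hT
      swap
      · simp; positivity
      have e1 := card_biUnion_le_card_mul {t' ∈ J | IsFace (𝓑 t') (placed (u t') s) T} X N
        fun t' ht' => hX t' (mem_filter.1 ht').1
      have e2 := htotal J hJI u T (by omega) (h3 T (by omega))
      rw [show r - 1 - T.card = 0 by omega, pow_zero, mul_one] at e2
      have e3 : 2 * C₀ * lam ^ T.card ≤ 2 * C₀ * lam ^ r :=
        Nat.mul_le_mul_left _ (Nat.pow_le_pow_right (by omega) (by omega))
      have e4 := e1.trans (Nat.mul_le_mul_right N (e2.trans e3))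
      calc _ ≤ ((2 * C₀ * lam ^ r * N : ℕ) : ℝ) := by exact_mod_cast e4
        _ = _ := by push_cast; ring
    obtain ⟨w, hw⟩ := exists_placement_step ((𝓑 t).sup id) s N (cand t)
      (fun T => bad1 T ∪ bad2 T ∪ bad3 T) m _ (hN t htI) (hloc t htI) (hcand t htI) (fun T => by
        have := (card_union_le (bad1 T ∪ bad2 T) (bad3 T)).trans
          (Nat.add_le_add_right (card_union_le _ _) _)
        have : ((bad1 T ∪ bad2 T ∪ bad3 T).card : ℝ) ≤
          (bad1 T).card + (bad2 T).card + (bad3 T).card := by exact_mod_cast this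
        exact this.trans (add_le_add (add_le_add (hbad1 T) (hbad2 T)) (hbad3 T))) hm fun _ => v₀
    have hwV : ∀ i < s, w i ∈ V := fun i hi => hcandV t htI _ _ (hw i hi).1
    have hplV : ∀ i ≤ s, placed w i ⊆ V := by
      intro i hi v hv
      obtain ⟨j, hj, rfl⟩ := mem_placed.1 hv
      exact hwV j (by omega)
    -- every face outside the root sets was tested when its last vertex was placed
    have hlast : ∀ B ∈ 𝓑 t, ∀ S, S ⊆ B ∪ placed w s → ¬ S ⊆ B → ∃ v ∈ S, v ∈ V ∧
        S.erase v ⊆ V ∧ v ∉ bad1 (S.erase v) ∧ v ∉ bad2 (S.erase v) ∧ v ∉ bad3 (S.erase v) := by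
      intro B hB S hS hSB
      obtain ⟨i, hi, hiS, hsub⟩ := exists_last_placed hS hSB
      have h := (hw i hi).2.2 (S.erase (w i))
        (hsub.trans (union_subset_union_left (le_sup (f := id) hB)))
      simp only [mem_union, not_or] at h
      exact ⟨w i, hiS, hwV i hi, hsub.trans (union_subset (h𝓑V t htI B hB) (hplV i hi.le)),
        h.1.1, h.1.2, h.2⟩
    let u' := Function.update u t w
    have hu't : u' t = w := Function.update_self _ _ _
    have hu'J : ∀ t' ∈ J, u' t' = u t' := fun t' ht' => by
      refine Function.update_of_ne ?_ _ _
      rintro rfl; exact htJ ht'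
    have hcross : ∀ t' ∈ J, ∀ S, IsFace (𝓑 t) (placed w s) S →
        IsFace (𝓑 t') (placed (u t') s) S → S.card + 1 ≤ r := by
      intro t' ht' S hS hS'
      by_contra hcon
      obtain ⟨S₀, hS₀, hcard⟩ := exists_subset_card_eq (s := S) (n := r) (by omega)
      obtain ⟨B, hB, hSB⟩ := hS.mono hS₀
      obtain ⟨v, hvS, hvV, -, -, -, hv3⟩ := hlast B hB S₀ hSB fun h => by
        have := card_le_card h
        have := h𝓑r t htI B hB
        omega
      have hface := hS'.mono hS₀
      refine hv3 ?_
      simp only [bad3]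
      rw [if_pos (by rw [card_erase_of_mem hvS]; omega), mem_biUnion]
      exact ⟨t', mem_filter.2 ⟨ht', hface.mono (erase_subset _ _)⟩, hXface t' _ hface hvS⟩
    refine ⟨u', ?_, ?_, ?_⟩
    · intro t' ht'
      rcases mem_insert.1 ht' with rfl | ht'
      · rw [hu't]
        refine ⟨fun i hi => ⟨(hw i hi).1, (hw i hi).2.1⟩, ?_⟩
        rintro S ⟨B, hB, hSB⟩ hcard hSO
        obtain ⟨v, hvS, hvV, hSV, -, hv2, -⟩ := hlast B hB S hSB fun h => by
          have := card_le_card h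
          have := h𝓑r t' htI B hB
          omega
        refine hv2 (mem_filter.2 ⟨hvV, hSV, ?_, ?_⟩)
        · rw [card_erase_of_mem hvS]; omega
        · rwa [insert_erase hvS]
      · rw [hu'J t' ht']
        exact h1 t' ht'
    · intro t₁ ht₁ t₂ ht₂ hne S
      rcases mem_insert.1 ht₁ with rfl | ht₁' <;> rcases mem_insert.1 ht₂ with rfl | ht₂'
      · exact absurd rfl hne
      · rw [hu't, hu'J t₂ ht₂']
        exact hcross t₂ ht₂' S
      · rw [hu't, hu'J t₁ ht₁']
        exact fun hS hS' => hcross t₁ ht₁' S hS' hS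
      · rw [hu'J t₁ ht₁', hu'J t₂ ht₂']
        exact h2 t₁ ht₁' t₂ ht₂' hne S
    · intro S hS
      have hold : ({t' ∈ J | IsFace (𝓑 t') (placed (u' t') s) S ∧ ¬ ∃ B ∈ 𝓑 t', S ⊆ B} : Finset ι)
          = {t' ∈ J | IsFace (𝓑 t') (placed (u t') s) S ∧ ¬ ∃ B ∈ 𝓑 t', S ⊆ B} :=
        filter_congr fun t' ht' => by rw [hu'J t' ht']
      simp only [cF]
      rw [filter_insert]
      split_ifs with hnew
      swap
      · rw [hold]; exact h3 S hS
      refine (card_insert_le _ _).trans ?_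
      rw [hold]
      rw [hu't] at hnew
      obtain ⟨⟨B, hB, hSB⟩, hnot⟩ := hnew
      obtain ⟨v, hvS, hvV, -, hv1, -, -⟩ := hlast B hB S hSB fun h => hnot ⟨B, hB, h⟩
      have hcard := card_erase_of_mem hvS
      have hpos := card_pos.2 ⟨v, hvS⟩
      by_contra hcon
      refine hv1 (mem_filter.2 ⟨hvV, notMem_erase _ _, by omega, ?_⟩)
      rw [insert_erase hvS, show (S.erase v).card + 1 = S.card by omega,
        show r - 2 - (S.erase v).card = r - 1 - S.card by omega]
      simp only [cF]
      omega

end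

/-! ### Degrees and divisibility -/

/-- The degree of `S` in a set system: the number of members that contain `S`. -/
def degree {α : Type*} [DecidableEq α] (E : Finset (Finset α)) (S : Finset α) : ℕ :=
  #{e ∈ E | S ⊆ e}

namespace RGraph

lemma IsCopy.comp {α β γ : Type*} [DecidableEq α] [DecidableEq γ] {r : ℕ} {F : RGraph r β}
    {F' : RGraph r α} {F'' : RGraph r γ} (h : IsCopy F F') {φ : α → γ} (hφ : Set.InjOn φ F'.verts)
    (hV : F''.verts = F'.verts.image φ) (hE : F''.edges = F'.edges.image (image φ)) :
    IsCopy F F'' := by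
  obtain ⟨ψ, hψ, hV', hE'⟩ := h
  refine ⟨φ ∘ ψ, ?_, ?_, ?_⟩
  · refine hφ.comp hψ fun v hv => ?_
    rw [hV']
    exact mem_coe.2 (mem_image_of_mem _ hv)
  · rw [hV, hV', image_image]
  · rw [hE, hE', image_image]
    refine image_congr fun e _ => ?_
    simp [image_image]

/-- The image of an `r`-graph under a map of vertices. Images of edges that are not `r`-sets are
discarded, so that no injectivity is required. -/
def map {α β : Type*} [DecidableEq α] {r : ℕ} (φ : β → α) (F : RGraph r β) : RGraph r α where
  verts := F.verts.image φ
  edges := {e ∈ F.edges.image (image φ) | e.card = r}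
  subset_verts := by
    intro e he
    obtain ⟨e', he', rfl⟩ := mem_image.1 (mem_filter.1 he).1
    exact image_subset_image (F.subset_verts e' he')
  card_eq := fun e he => (mem_filter.1 he).2

lemma map_edges {α β : Type*} [DecidableEq α] {r : ℕ} {F : RGraph r β} {φ : β → α}
    (hφ : Set.InjOn φ F.verts) :
    (F.map φ).edges = F.edges.image (image φ) := by
  refine filter_true_of_mem fun e he => ?_
  obtain ⟨e', he', rfl⟩ := mem_image.1 he
  rw [card_image_of_injOn (hφ.mono (coe_subset.2 (F.subset_verts e' he'))), F.card_eq e' he']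

end RGraph

section
variable {α β : Type*} [DecidableEq α] [DecidableEq β] {r : ℕ}

lemma RGraph.card_link (G : RGraph r α) (S : Finset α) : (G.link S).card = degree G.edges S := by
  unfold RGraph.link degree
  refine card_nbij' (fun e => S ∪ e) (fun e => e \ S) ?_ ?_ ?_ ?_
  · intro e he
    simp only [coe_filter, Set.mem_ofPred_eq, mem_powerset] at he ⊢
    exact ⟨he.2, subset_union_left⟩
  · intro e he
    simp only [coe_filter, Set.mem_ofPred_eq, mem_powerset] at he ⊢
    rw [union_sdiff_of_subset he.2]
    exact ⟨sdiff_subset_sdiff (G.subset_verts e he.1) (Subset.refl _), he.1⟩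
  · intro e he
    simp only [coe_filter, Set.mem_ofPred_eq, mem_powerset] at he
    have := (subset_sdiff.1 he.1).2
    exact (union_sdiff_left S e).trans (sdiff_eq_self_of_disjoint this)
  · intro e he
    simp only [coe_filter, Set.mem_ofPred_eq] at he
    exact union_sdiff_of_subset he.2

lemma degree_biUnion {ι : Type*} (J : Finset ι) (E : ι → Finset (Finset α))
    (h : ∀ i ∈ J, ∀ j ∈ J, i ≠ j → Disjoint (E i) (E j)) (S : Finset α) :
    degree (J.biUnion E) S = ∑ i ∈ J, degree (E i) S := by
  unfold degree
  rw [filter_biUnion, card_biUnion]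
  intro i hi j hj hij
  exact disjoint_filter_filter (h i hi j hj hij)

lemma degree_union {E E' : Finset (Finset α)} (h : Disjoint E E') (S : Finset α) :
    degree (E ∪ E') S = degree E S + degree E' S := by
  unfold degree
  rw [filter_union, card_union_of_disjoint (disjoint_filter_filter h)]

lemma degree_sdiff {E E' : Finset (Finset α)} (h : E' ⊆ E) (S : Finset α) :
    (degree (E \ E') S : ℤ) = degree E S - degree E' S := by
  have := degree_union (E := E \ E') (E' := E') sdiff_disjoint S
  rw [sdiff_union_of_subset h] at this
  rw [this]; push_cast; ring

lemma card_powersetCard_superset {T e : Finset α} (hT : T ⊆ e) {k : ℕ} (hk : T.card ≤ k) :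
    #{S ∈ e.powersetCard k | T ⊆ S} = (e.card - T.card).choose (k - T.card) := by
  rw [← card_sdiff_of_subset hT, ← card_powersetCard]
  refine card_nbij' (fun S => S \ T) (fun S => S ∪ T) ?_ ?_ ?_ ?_
  · intro S hS
    simp only [coe_filter, Set.mem_ofPred_eq, mem_powersetCard, mem_coe] at hS ⊢
    exact ⟨sdiff_subset_sdiff hS.1.1 (Subset.refl _), by rw [card_sdiff_of_subset hS.2, hS.1.2]⟩
  · intro S hS
    simp only [coe_filter, Set.mem_ofPred_eq, mem_powersetCard, mem_coe] at hS ⊢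
    obtain ⟨h1, h2⟩ := subset_sdiff.1 hS.1
    refine ⟨⟨union_subset h1 hT, ?_⟩, subset_union_right⟩
    rw [card_union_of_disjoint h2, hS.2]; omega
  · intro S hS
    simp only [coe_filter, Set.mem_ofPred_eq] at hS
    exact sdiff_union_of_subset hS.2
  · intro S hS
    simp only [mem_powersetCard, mem_coe] at hS
    exact (union_sdiff_right S T).trans (sdiff_eq_self_of_disjoint (subset_sdiff.1 hS.1).2)

/-- Double counting: an edge that contains `T` contains `(r - |T|).choose (k - |T|)` sets of `k`
vertices that contain `T`. -/
lemma sum_degree_superset {E : Finset (Finset α)} {V : Finset α} (hV : ∀ e ∈ E, e ⊆ V)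
    (hr : ∀ e ∈ E, e.card = r) {k : ℕ} {T : Finset α} (hT : T.card ≤ k) :
    ∑ S ∈ V.powersetCard k with T ⊆ S, degree E S =
      (r - T.card).choose (k - T.card) * degree E T := by
  unfold degree
  simp only [card_filter]
  rw [sum_comm, mul_sum]
  refine sum_congr rfl fun e he => ?_
  rw [← card_filter, filter_filter]
  split_ifs with h
  · rw [mul_one, ← hr e he, ← card_powersetCard_superset h hT]
    congr 1
    ext S
    simp only [mem_filter, mem_powersetCard]
    exact ⟨fun h => ⟨⟨h.2.2, h.1.2⟩, h.2.1⟩, fun h => ⟨⟨h.1.1.trans (hV e he), h.1.2⟩, h.2, h.1.1⟩⟩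
  · rw [mul_zero, card_eq_zero, filter_eq_empty_iff]
    exact fun S _ h' => h (h'.1.trans h'.2)

lemma degree_image {φ : β → α} {V : Finset β} (hφ : Set.InjOn φ V) {E : Finset (Finset β)}
    (hE : ∀ e ∈ E, e ⊆ V) {S : Finset β} (hS : S ⊆ V) :
    degree (E.image (image φ)) (S.image φ) = degree E S := by
  unfold degree
  have hsub : ∀ A ⊆ V, ∀ B ⊆ V, A.image φ ⊆ B.image φ → A ⊆ B := by
    intro A hA B hB h v hv
    obtain ⟨w, hw, hwv⟩ := mem_image.1 (h (mem_image_of_mem φ hv))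
    rwa [← hφ (hB hw) (hA hv) hwv]
  rw [filter_image, card_image_of_injOn]
  · congr 1
    refine filter_congr fun e he => ⟨hsub S hS e (hE e he), image_subset_image⟩
  · intro e he e' he' h
    simp only [coe_filter, Set.mem_ofPred_eq] at he he'
    exact (hsub e (hE e he.1) e' (hE e' he'.1) h.subset).antisymm
      (hsub e' (hE e' he'.1) e (hE e he.1) h.symm.subset)

lemma degree_eq_zero {E : Finset (Finset α)} {V : Finset α} (hE : ∀ e ∈ E, e ⊆ V) {S : Finset α}
    (hS : ¬ S ⊆ V) : degree E S = 0 :=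
  card_eq_zero.2 (filter_eq_empty_iff.2 fun e he h => hS (h.trans (hE e he)))

namespace RGraph

lemma divDegree_dvd_degree (F : RGraph r β) (S : Finset β) :
    F.divDegree S.card ∣ degree F.edges S := by
  by_cases hS : S ⊆ F.verts
  · rw [← F.card_link]
    exact gcd_dvd (mem_powersetCard.2 ⟨hS, rfl⟩)
  · rw [degree_eq_zero F.subset_verts hS]
    exact dvd_zero _

lemma divDegree_dvd_degree_image (F : RGraph r β) {φ : β → α} (hφ : Set.InjOn φ F.verts)
    (S : Finset α) : F.divDegree S.card ∣ degree (F.edges.image (image φ)) S := by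
  by_cases hS : S ⊆ F.verts.image φ
  · obtain ⟨T, hT, rfl⟩ := subset_image_iff.1 hS
    rw [degree_image hφ F.subset_verts hT, card_image_of_injOn (hφ.mono (coe_subset.2 hT))]
    exact F.divDegree_dvd_degree T
  · rw [degree_eq_zero (V := F.verts.image φ) _ hS]
    · exact dvd_zero _
    · intro e he
      obtain ⟨e', he', rfl⟩ := mem_image.1 he
      exact image_subset_image (F.subset_verts e' he')

lemma IsCopy.divDegree_dvd_degree {F : RGraph r β} {F' : RGraph r α} (h : IsCopy F F')
    (S : Finset α) : F.divDegree S.card ∣ degree F'.edges S := by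
  obtain ⟨φ, hφ, -, hE⟩ := h
  rw [hE]
  exact F.divDegree_dvd_degree_image hφ S

lemma IsCopy.divDegree_dvd {F : RGraph r β} {F' : RGraph r α} (h : IsCopy F F') (i : ℕ) :
    F'.divDegree i ∣ F.divDegree i := by
  obtain ⟨φ, hφ, hV, hE⟩ := h
  refine dvd_gcd fun S hS => ?_
  obtain ⟨hSV, rfl⟩ := mem_powersetCard.1 hS
  rw [F.card_link, ← degree_image hφ F.subset_verts hSV, ← card_image_of_injOn
    (hφ.mono (coe_subset.2 hSV))]
  have := F'.divDegree_dvd_degree (S.image φ)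
  rwa [hE] at this

lemma divDegree_pos {F : RGraph r β} (hF : F.edges.Nonempty) {i : ℕ} (hi : i ≤ r) :
    0 < F.divDegree i ∧ F.divDegree i ≤ 2 ^ F.verts.card := by
  obtain ⟨e, he⟩ := hF
  obtain ⟨S, hS, rfl⟩ := exists_subset_card_eq (s := e) (n := i) (by rw [F.card_eq e he]; exact hi)
  have h1 := F.divDegree_dvd_degree S
  have h2 : 0 < degree F.edges S := card_pos.2 ⟨e, mem_filter.2 ⟨he, hS⟩⟩
  refine ⟨Nat.pos_of_dvd_of_pos h1 h2, (Nat.le_of_dvd h2 h1).trans ?_⟩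
  refine (card_filter_le _ _).trans ?_
  rw [← card_powerset]
  exact card_le_card fun e he => mem_powerset.2 (F.subset_verts e he)

lemma divDegree_dvd_choose_mul (F : RGraph r β) {i k : ℕ} (hik : i ≤ k) :
    F.divDegree k ∣ (r - i).choose (k - i) * F.divDegree i := by
  have : F.divDegree k ∣ (F.verts.powersetCard i).gcd
      fun S => (r - i).choose (k - i) * (F.link S).card := by
    refine dvd_gcd fun S hS => ?_
    obtain ⟨hS, rfl⟩ := mem_powersetCard.1 hS
    rw [F.card_link, ← sum_degree_superset F.subset_verts F.card_eq hik]
    refine dvd_sum fun S' hS' => ?_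
    have := F.divDegree_dvd_degree S'
    rwa [(mem_powersetCard.1 (mem_filter.1 hS').1).2] at this
  rwa [Finset.gcd_mul_left, normalize_eq] at this

/-- Distinct members of a `1`-well separated family share fewer than `r` vertices. -/
lemma IsWellSeparated.card_inter_lt {𝓕 : Finset (RGraph r α)} (h : IsWellSeparated 1 𝓕)
    {F₁ F₂ : RGraph r α} (h₁ : F₁ ∈ 𝓕) (h₂ : F₂ ∈ 𝓕) (hne : F₁ ≠ F₂) :
    (F₁.verts ∩ F₂.verts).card < r := by
  by_contra hcon
  obtain ⟨e, he, hcard⟩ := exists_subset_card_eq (not_lt.1 hcon)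
  have h3 := h.2 e hcard
  exact hne (card_le_one.1 h3 F₁ (mem_filter.2 ⟨h₁, he.trans inter_subset_left⟩) F₂
    (mem_filter.2 ⟨h₂, he.trans inter_subset_right⟩))

lemma isWellSeparated_one {𝓕 : Finset (RGraph r α)}
    (h : ∀ F₁ ∈ 𝓕, ∀ F₂ ∈ 𝓕, F₁ ≠ F₂ → (F₁.verts ∩ F₂.verts).card < r) :
    IsWellSeparated 1 𝓕 := by
  refine ⟨fun F₁ h₁ F₂ h₂ hne => (h F₁ h₁ F₂ h₂ hne).le, fun e he => card_le_one.2 ?_⟩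
  intro F₁ h₁ F₂ h₂
  rw [mem_filter] at h₁ h₂
  by_contra hne
  have h3 := h F₁ h₁.1 F₂ h₂.1 hne
  have := card_le_card (subset_inter h₁.2 h₂.2)
  omega

lemma disjoint_edges_of_card_inter_lt {F₁ F₂ : RGraph r α}
    (h : (F₁.verts ∩ F₂.verts).card < r) : Disjoint F₁.edges F₂.edges := by
  rw [disjoint_left]
  intro e h₁ h₂
  have := card_le_card (subset_inter (F₁.subset_verts e h₁) (F₂.subset_verts e h₂))
  rw [F₁.card_eq e h₁] at this
  omega

end RGraph

/-- The signed number of choice vectors `z` for which an edge `e` of the `z`-th copy contains `S`.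
If the copies differ only in the `k` vertices `s i`, which are mapped to `x i (z i)`, then
everything cancels up to dimension `k` except for the transversals of `x`. -/
lemma sum_flipSign_mul_subset {k : ℕ} {x : Fin k → Bool → α}
    (hx : Function.Injective fun p : Fin k × Bool => x p.1 p.2) (s : Fin k → β)
    (θ : (Fin k → Bool) → β → α) (e : Finset β) (hθs : ∀ z i, θ z (s i) = x i (z i))
    (hθ : ∀ z z', ∀ v ∈ e, v ∉ Set.range s → θ z v = θ z' v)
    (hθx : ∀ z, ∀ v ∈ e, v ∉ Set.range s → ∀ i b, θ z v ≠ x i b)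
    {S : Finset α} (hS : S.card ≤ k) :
    ∑ z, flipSign z * (if S ⊆ e.image (θ z) then 1 else 0) =
      octahedron x S * if univ.image s ⊆ e then 1 else 0 := by
  by_cases h : ∃ i, ∀ b, x i b ∉ S
  · obtain ⟨i, hi⟩ := h
    rw [octahedron_eq_zero, zero_mul]
    · refine sum_flipSign_mul_eq_zero i _ fun z => ?_
      have key : ∀ z b, S ⊆ e.image (θ z) → S ⊆ e.image (θ (Function.update z i b)) := by
        intro z b h v hv
        obtain ⟨w, hw, rfl⟩ := mem_image.1 (h hv)
        refine mem_image.2 ⟨w, hw, ?_⟩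
        by_cases hws : w ∈ Set.range s
        · obtain ⟨j, rfl⟩ := hws
          rw [hθs] at hv ⊢
          rw [hθs, Function.update_of_ne]
          rintro rfl
          exact hi _ hv
        · exact hθ _ _ w hw hws
      congr 1
      refine propext ⟨fun h => ?_, key z _⟩
      simpa using key _ (z i) h
    · rintro z rfl
      exact hi (z i) ((mem_transversal_iff hx z i _).2 rfl)
  · push Not at h
    choose z₀ hz₀ using h
    have hSz : S = transversal x z₀ := by
      symm
      refine eq_of_subset_of_card_le ?_ (by rwa [card_transversal hx])
      intro v hv
      simp only [transversal, mem_image, mem_univ, true_and] at hv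
      obtain ⟨i, rfl⟩ := hv
      exact hz₀ i
    have hiff : ∀ z, S ⊆ e.image (θ z) ↔ z = z₀ ∧ univ.image s ⊆ e := by
      intro z
      constructor
      · intro h
        have h1 : ∀ i, z i = z₀ i ∧ s i ∈ e := by
          intro i
          obtain ⟨v, hv, hvi⟩ := mem_image.1 (h (hz₀ i))
          by_cases hvs : v ∈ Set.range s
          · obtain ⟨j, rfl⟩ := hvs
            rw [hθs] at hvi
            have := @hx (j, z j) (i, z₀ i) hvi
            simp only [Prod.mk.injEq] at this
            obtain ⟨rfl, h2⟩ := this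
            exact ⟨h2, hv⟩
          · exact absurd hvi (hθx z v hv hvs _ _)
        exact ⟨funext fun i => (h1 i).1, image_subset_iff.2 fun i _ => (h1 i).2⟩
      · rintro ⟨rfl, h⟩
        rw [hSz]
        refine image_subset_iff.2 fun i _ => mem_image.2 ⟨s i, ?_, hθs _ _⟩
        exact h (mem_image_of_mem _ (mem_univ i))
    simp only [hiff]
    rw [sum_eq_single_of_mem z₀ (mem_univ _) (fun z _ hz => by simp [hz])]
    rw [hSz, octahedron_transversal hx]
    simp

end

/-! ### Gadgets -/

/-- The edge set of a gadget: for each `p` in the index set `P`, the image under `θ p` of all edges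
of `Fs` outside `F₀`. The maps `θ p` are to be injective, and the images of different parts are to
meet in images of vertices of `F₀` only. -/
def gadgetEdges {α β ι : Type*} [DecidableEq α] [DecidableEq β] {r : ℕ} (Fs F₀ : RGraph r β)
    (P : Finset ι) (θ : ι → β → α) : Finset (Finset α) :=
  P.biUnion fun p => (Fs.edges \ F₀.edges).image (image (θ p))

open Classical in
/-- The copies of `F` that decompose a gadget: the images of all members of the decomposition `𝓕`
of `Fs` other than `F₀`. -/
noncomputable def gadgetCopies {α β ι : Type*} [DecidableEq α] {r : ℕ} (𝓕 : Finset (RGraph r β))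
    (F₀ : RGraph r β) (P : Finset ι) (θ : ι → β → α) : Finset (RGraph r α) :=
  P.biUnion fun p => (𝓕.erase F₀).image (RGraph.map (θ p))

lemma mem_gadgetCopies {α β ι : Type*} [DecidableEq α] {r : ℕ} {𝓕 : Finset (RGraph r β)}
    {F₀ : RGraph r β} {P : Finset ι} {θ : ι → β → α} {F' : RGraph r α} :
    F' ∈ gadgetCopies 𝓕 F₀ P θ ↔ ∃ p ∈ P, ∃ F₁ ∈ 𝓕, F₁ ≠ F₀ ∧ F₁.map (θ p) = F' := by
  classical
  unfold gadgetCopies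
  simp only [mem_biUnion, mem_image, mem_erase]
  exact exists_congr fun p => and_congr_right fun _ => exists_congr fun F₁ => by tauto

section
variable {α β δ ι : Type*} [DecidableEq α] [DecidableEq β] {r : ℕ}
  {F : RGraph r δ} {Fs F₀ : RGraph r β} {𝓕 : Finset (RGraph r β)} {P : Finset ι} {θ : ι → β → α}

/-- By well-separatedness, an edge of `Fs` that is not an edge of `F₀` has a vertex outside `F₀`. -/
lemma RGraph.IsDecomposition.not_subset_verts (h𝓕 : RGraph.IsDecomposition F Fs 𝓕)
    (hsep : RGraph.IsWellSeparated 1 𝓕) (hF₀ : F₀ ∈ 𝓕) {e : Finset β}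
    (he : e ∈ Fs.edges \ F₀.edges) : ¬ e ⊆ F₀.verts := by
  intro h
  rw [mem_sdiff] at he
  obtain ⟨F₁, hF₁, heF₁⟩ := h𝓕.2 e he.1
  have h1 := hsep.card_inter_lt hF₁ hF₀ (by rintro rfl; exact he.2 heF₁)
  have h2 := card_le_card (subset_inter (F₁.subset_verts e heF₁) h)
  rw [F₁.card_eq e heF₁] at h2
  omega

variable (h𝓕 : RGraph.IsDecomposition F Fs 𝓕) (hsep : RGraph.IsWellSeparated 1 𝓕)
  (hF₀ : F₀ ∈ 𝓕) (hinj : ∀ p ∈ P, Set.InjOn (θ p) Fs.verts)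
  (hcross : ∀ p ∈ P, ∀ p' ∈ P, p ≠ p' → ∀ v ∈ Fs.verts, ∀ v' ∈ Fs.verts,
    θ p v = θ p' v' → v ∈ F₀.verts)

include h𝓕 hinj in
lemma isCopy_of_mem_gadgetCopies {F' : RGraph r α} (h : F' ∈ gadgetCopies 𝓕 F₀ P θ) :
    RGraph.IsCopy F F' ∧ ∃ p ∈ P, F'.verts ⊆ Fs.verts.image (θ p) := by
  obtain ⟨p, hp, F₁, hF₁, hne, rfl⟩ := mem_gadgetCopies.1 h
  obtain ⟨h1, h2⟩ := h𝓕.1.1 F₁ hF₁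
  have h3 : Set.InjOn (θ p) F₁.verts := (hinj p hp).mono (coe_subset.2 h2.1)
  exact ⟨h1.comp h3 rfl (RGraph.map_edges h3), p, hp, image_subset_image h2.1⟩

include h𝓕 hF₀ hinj in
lemma mem_gadgetEdges_iff {e : Finset α} :
    e ∈ gadgetEdges Fs F₀ P θ ↔ ∃ F' ∈ gadgetCopies 𝓕 F₀ P θ, e ∈ F'.edges := by
  simp only [gadgetEdges, mem_biUnion, mem_image, mem_sdiff]
  constructor
  · rintro ⟨p, hp, e, ⟨he, he'⟩, rfl⟩
    obtain ⟨F₁, hF₁, heF₁⟩ := h𝓕.2 e he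
    refine ⟨_, mem_gadgetCopies.2 ⟨p, hp, F₁, hF₁, ?_, rfl⟩, ?_⟩
    · rintro rfl; exact he' heF₁
    · rw [RGraph.map_edges ((hinj p hp).mono (coe_subset.2 (h𝓕.1.1 F₁ hF₁).2.1))]
      exact mem_image_of_mem _ heF₁
  · rintro ⟨F', hF', he⟩
    obtain ⟨p, hp, F₁, hF₁, hne, rfl⟩ := mem_gadgetCopies.1 hF'
    rw [RGraph.map_edges ((hinj p hp).mono (coe_subset.2 (h𝓕.1.1 F₁ hF₁).2.1))] at he
    obtain ⟨e', he', rfl⟩ := mem_image.1 he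
    refine ⟨p, hp, e', ⟨(h𝓕.1.1 F₁ hF₁).2.2 he', fun h => ?_⟩, rfl⟩
    exact disjoint_left.1 (h𝓕.1.2 F₁ hF₁ F₀ hF₀ hne) he' h

include h𝓕 hsep hF₀ hinj hcross in
/-- Copies from different parts of a gadget meet only in vertices of the shared copy of `F₀`, and
every other member of the decomposition has fewer than `r` vertices there. -/
lemma card_inter_lt_of_mem_gadgetCopies {F₁ F₂ : RGraph r α} (h₁ : F₁ ∈ gadgetCopies 𝓕 F₀ P θ)
    (h₂ : F₂ ∈ gadgetCopies 𝓕 F₀ P θ) (hne : F₁ ≠ F₂) : (F₁.verts ∩ F₂.verts).card < r := by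
  obtain ⟨p, hp, A, hA, hAne, rfl⟩ := mem_gadgetCopies.1 h₁
  obtain ⟨q, hq, B, hB, hBne, rfl⟩ := mem_gadgetCopies.1 h₂
  have hAV := (h𝓕.1.1 A hA).2.1
  have hBV := (h𝓕.1.1 B hB).2.1
  by_cases hpq : p = q
  · subst hpq
    have hAB : A ≠ B := by rintro rfl; exact hne rfl
    refine lt_of_le_of_lt (card_le_card (t := (A.verts ∩ B.verts).image (θ p)) ?_)
      (card_image_le.trans_lt (hsep.card_inter_lt hA hB hAB))
    intro v hv
    simp only [RGraph.map, mem_inter, mem_image] at hv ⊢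
    obtain ⟨⟨a, ha, rfl⟩, b, hb, hab⟩ := hv
    have := hinj p hp (hBV hb) (hAV ha) hab
    subst this
    exact ⟨b, ⟨ha, hb⟩, rfl⟩
  · refine lt_of_le_of_lt (card_le_card (t := (A.verts ∩ F₀.verts).image (θ p)) ?_)
      (card_image_le.trans_lt (hsep.card_inter_lt hA hF₀ hAne))
    intro v hv
    simp only [RGraph.map, mem_inter, mem_image] at hv ⊢
    obtain ⟨⟨a, ha, rfl⟩, b, hb, hab⟩ := hv
    exact ⟨a, ⟨ha, hcross p hp q hq hpq a (hAV ha) b (hBV hb) hab.symm⟩, rfl⟩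

include h𝓕 hsep hF₀ hinj hcross in
lemma divDegree_dvd_degree_gadgetEdges [DecidableEq δ] (S : Finset α) :
    F.divDegree S.card ∣ degree (gadgetEdges Fs F₀ P θ) S := by
  have h : gadgetEdges Fs F₀ P θ = (gadgetCopies 𝓕 F₀ P θ).biUnion RGraph.edges := by
    ext e
    rw [mem_gadgetEdges_iff h𝓕 hF₀ hinj, mem_biUnion]
  rw [h, degree_biUnion]
  · exact dvd_sum fun F' hF' =>
      (isCopy_of_mem_gadgetCopies h𝓕 hinj hF').1.divDegree_dvd_degree S
  · intro F₁ h₁ F₂ h₂ hne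
    exact RGraph.disjoint_edges_of_card_inter_lt
      (card_inter_lt_of_mem_gadgetCopies h𝓕 hsep hF₀ hinj hcross h₁ h₂ hne)

include h𝓕 hsep hF₀ hinj hcross in
/-- As the degrees of `Fs` vanish modulo `Deg(Fs)`, each part of a gadget contributes the negative
of the degrees of the corresponding copy of `F₀`. -/
lemma divDegree_dvd_degree_gadgetEdges_add (S : Finset α) :
    (Fs.divDegree S.card : ℤ) ∣ degree (gadgetEdges Fs F₀ P θ) S +
      ∑ p ∈ P, (degree (F₀.edges.image (image (θ p))) S : ℤ) := by
  have hsub : F₀.edges ⊆ Fs.edges := (h𝓕.1.1 F₀ hF₀).2.2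
  unfold gadgetEdges
  rw [degree_biUnion]
  · push_cast
    rw [← sum_add_distrib]
    refine dvd_sum fun p hp => ?_
    have h1 : (Fs.edges \ F₀.edges).image (image (θ p)) =
        Fs.edges.image (image (θ p)) \ F₀.edges.image (image (θ p)) := by
      refine image_sdiff_of_injOn (fun e he e' he' h => ?_) hsub
      have hinj' := hinj p hp
      have key : ∀ e ∈ Fs.edges, ∀ e' ∈ Fs.edges, e.image (θ p) = e'.image (θ p) → e ⊆ e' := by
        intro e he e' he' h v hv
        obtain ⟨w, hw, hwv⟩ := mem_image.1 (h ▸ mem_image_of_mem (θ p) hv)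
        rwa [← hinj' (Fs.subset_verts e' he' hw) (Fs.subset_verts e he hv) hwv]
      exact (key e he e' he' h).antisymm (key e' he' e he h.symm)
    rw [h1, degree_sdiff (image_subset_image hsub), sub_add_cancel]
    exact_mod_cast Fs.divDegree_dvd_degree_image (hinj p hp) S
  · intro p hp q hq hpq
    rw [disjoint_left]
    intro e he he'
    obtain ⟨a, ha, rfl⟩ := mem_image.1 he
    obtain ⟨b, hb, hab⟩ := mem_image.1 he'
    refine h𝓕.not_subset_verts hsep hF₀ ha fun v hv => ?_
    obtain ⟨w, hw, hwv⟩ := mem_image.1 (hab ▸ mem_image_of_mem (θ p) hv)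
    exact hcross p hp q hq hpq v (Fs.subset_verts a (mem_sdiff.1 ha).1 hv) w
      (Fs.subset_verts b (mem_sdiff.1 hb).1 hw) hwv.symm

end

/-- The number of parts of a gadget with choice vector `z`; it is `-(-1)^{|z|}` modulo `M`, because
each part contributes the negative of the degrees of `F₀`. -/
def partCount {k : ℕ} (M : ℕ) (z : Fin k → Bool) : ℕ := if flipSign z = 1 then M - 1 else 1

/-- The index set of the parts of a gadget: for each choice vector `z`, there are `partCount M z`
parts whose copy of `F₀` passes through the transversal selected by `z`. -/
def gadgetIndex (k M : ℕ) : Finset ((_ : Fin k → Bool) × ℕ) :=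
  univ.sigma fun z => range (partCount M z)

/-- A gadget changes the degrees of the transversals of `x` by `±|F₀(s)|`, and does not change any
other degree at sets of at most `k` vertices, modulo `Deg(Fs)`. Here `θ₀ z` is the common
restriction to `F₀` of the parts with choice vector `z`: it maps `s i` to `x i (z i)`, and its other
values do not depend on `z`. -/
lemma divDegree_dvd_degree_gadgetEdges_sub {α β δ : Type*} [DecidableEq α] [DecidableEq β] {r : ℕ}
    {F : RGraph r δ} {Fs F₀ : RGraph r β} {𝓕 : Finset (RGraph r β)}
    (h𝓕 : RGraph.IsDecomposition F Fs 𝓕) (hsep : RGraph.IsWellSeparated 1 𝓕) (hF₀ : F₀ ∈ 𝓕)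
    {k M : ℕ} (hM : 1 ≤ M) {θ : (_ : Fin k → Bool) × ℕ → β → α}
    (hinj : ∀ p ∈ gadgetIndex k M, Set.InjOn (θ p) Fs.verts)
    (hcross : ∀ p ∈ gadgetIndex k M, ∀ p' ∈ gadgetIndex k M, p ≠ p' → ∀ v ∈ Fs.verts,
      ∀ v' ∈ Fs.verts, θ p v = θ p' v' → v ∈ F₀.verts)
    {x : Fin k → Bool → α} (hx : Function.Injective fun p : Fin k × Bool => x p.1 p.2)
    {s : Fin k → β} {θ₀ : (Fin k → Bool) → β → α}
    (hθ₀ : ∀ p, ∀ v ∈ F₀.verts, θ p v = θ₀ p.1 v)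
    (hinj₀ : ∀ z, Set.InjOn (θ₀ z) F₀.verts) (hθs : ∀ z i, θ₀ z (s i) = x i (z i))
    (hθ : ∀ z z', ∀ v ∈ F₀.verts, v ∉ Set.range s → θ₀ z v = θ₀ z' v)
    (hθx : ∀ z, ∀ v ∈ F₀.verts, v ∉ Set.range s → ∀ i b, θ₀ z v ≠ x i b)
    {S : Finset α} (hS : S.card ≤ k) (hdvd : Fs.divDegree S.card ∣ M) :
    (Fs.divDegree S.card : ℤ) ∣ degree (gadgetEdges Fs F₀ (gadgetIndex k M) θ) S -
      octahedron x S * degree F₀.edges (univ.image s) := by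
  let g : (Fin k → Bool) → ℤ := fun z => degree (F₀.edges.image (image (θ₀ z))) S
  have h1 : ∑ p ∈ gadgetIndex k M, (degree (F₀.edges.image (image (θ p))) S : ℤ) =
      ∑ z, (partCount M z : ℤ) * g z := by
    rw [gadgetIndex, sum_sigma]
    refine sum_congr rfl fun z _ => ?_
    rw [sum_congr rfl (g := fun _ => g z), sum_const, card_range, nsmul_eq_mul]
    intro c _
    have : F₀.edges.image (image (θ ⟨z, c⟩)) = F₀.edges.image (image (θ₀ z)) :=
      image_congr fun e he => image_congr fun v hv => hθ₀ _ v (F₀.subset_verts e he hv)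
    simp only [g, this]
  have h2 : ∑ z, flipSign z * g z = octahedron x S * degree F₀.edges (univ.image s) := by
    have h3 : ∀ z, g z = ∑ e ∈ F₀.edges, if S ⊆ e.image (θ₀ z) then 1 else 0 := by
      intro z
      simp only [g, degree]
      rw [card_filter, sum_image]
      · push_cast; rfl
      · intro e he e' he' h
        have key : ∀ e ∈ F₀.edges, ∀ e' ∈ F₀.edges, e.image (θ₀ z) = e'.image (θ₀ z) →
            e ⊆ e' := by
          intro e he e' he' h v hv
          obtain ⟨w, hw, hwv⟩ := mem_image.1 (h ▸ mem_image_of_mem (θ₀ z) hv)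
          rwa [← hinj₀ z (F₀.subset_verts e' he' hw) (F₀.subset_verts e he hv) hwv]
        exact (key e he e' he' h).antisymm (key e' he' e he h.symm)
    simp only [h3, mul_sum]
    rw [sum_comm]
    simp only [degree, card_filter]
    push_cast
    rw [mul_sum]
    refine sum_congr rfl fun e he => ?_
    exact sum_flipSign_mul_subset hx s θ₀ e hθs
      (fun z z' v hv => hθ z z' v (F₀.subset_verts e he hv))
      (fun z v hv => hθx z v (F₀.subset_verts e he hv)) hS
  have h4 : ∀ z : Fin k → Bool, (M : ℤ) ∣ partCount M z + flipSign z := by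
    intro z
    unfold partCount
    rcases flipSign_eq z with h | h <;> rw [h]
    · rw [if_pos rfl]; push_cast [hM]; simp
    · simp
  have h5 : (Fs.divDegree S.card : ℤ) ∣ ∑ z, ((partCount M z : ℤ) * g z + flipSign z * g z) := by
    refine dvd_sum fun z _ => ?_
    rw [← add_mul]
    exact Dvd.dvd.mul_right ((Int.natCast_dvd_natCast.2 hdvd).trans (h4 z)) _
  rw [sum_add_distrib, h2, ← h1] at h5
  have h6 := dvd_sub (divDegree_dvd_degree_gadgetEdges_add h𝓕 hsep hF₀ hinj hcross S) h5
  have h7 := add_sub_add_right_eq_sub (degree (gadgetEdges Fs F₀ (gadgetIndex k M) θ) S : ℤ)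
    (octahedron x S * degree F₀.edges (univ.image s))
    (∑ p ∈ gadgetIndex k M, (degree (F₀.edges.image (image (θ p))) S : ℤ))
  rw [add_comm (octahedron x S * _)] at h7
  rwa [h7] at h6

/-! ### Vertex maps of gadgets -/

lemma partCount_le {k M : ℕ} (hM : 1 ≤ M) (z : Fin k → Bool) : partCount M z ≤ M := by
  unfold partCount; split_ifs <;> omega

/-- An enumeration of the parts of a gadget, starting at `1`. -/
noncomputable def partNumber {k : ℕ} (M : ℕ) (p : (_ : Fin k → Bool) × ℕ) : ℕ :=
  1 + Fintype.equivFin (Fin k → Bool) p.1 * M + p.2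

lemma partNumber_le {k M : ℕ} (hM : 1 ≤ M) {p : (_ : Fin k → Bool) × ℕ}
    (hp : p ∈ gadgetIndex k M) : partNumber M p ≤ 2 ^ k * M := by
  have h1 : p.2 < M := by
    have := (mem_sigma.1 hp).2
    exact (mem_range.1 this).trans_le (partCount_le hM _)
  have h2 : (Fintype.equivFin (Fin k → Bool) p.1 : ℕ) < 2 ^ k :=
    (Fintype.equivFin (Fin k → Bool) p.1).isLt.trans_eq (by simp)
  have h3 := Nat.mul_le_mul_right M (Nat.succ_le_of_lt h2)
  rw [Nat.succ_mul] at h3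
  unfold partNumber
  omega

lemma partNumber_inj {k M : ℕ} (hM : 1 ≤ M) {p q : (_ : Fin k → Bool) × ℕ}
    (hp : p ∈ gadgetIndex k M) (hq : q ∈ gadgetIndex k M) (h : partNumber M p = partNumber M q) :
    p = q := by
  have h1 : p.2 < M := (mem_range.1 (mem_sigma.1 hp).2).trans_le (partCount_le hM _)
  have h2 : q.2 < M := (mem_range.1 (mem_sigma.1 hq).2).trans_le (partCount_le hM _)
  unfold partNumber at h
  have h3 : p.2 = q.2 := by
    have := congrArg (· % M) (show Fintype.equivFin (Fin k → Bool) p.1 * M + p.2 =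
      Fintype.equivFin (Fin k → Bool) q.1 * M + q.2 by omega)
    simpa [Nat.add_mod, Nat.mod_eq_of_lt h1, Nat.mod_eq_of_lt h2] using this
  have h4 : p.1 = q.1 := by
    have : (Fintype.equivFin (Fin k → Bool) p.1 : ℕ) * M =
      Fintype.equivFin (Fin k → Bool) q.1 * M := by omega
    exact (Fintype.equivFin _).injective (Fin.ext (Nat.eq_of_mul_eq_mul_right (by omega) this))
  obtain ⟨z, c⟩ := p
  obtain ⟨z', c'⟩ := q
  simp only at h3 h4
  subst h3 h4
  rfl

/-- The position, in the sequence of placed vertices, of the vertex `v` in part `p` of a gadget.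
Positions below `m` are shared by all parts and used for the vertices of `F₀`; the `b`-th part owns
the positions `m * b, …, m * b + m - 1`. -/
noncomputable def gadgetSlot {β : Type*} [DecidableEq β] {r k : ℕ} (F₀ : RGraph r β) (τ : β → ℕ)
    (m M : ℕ) (p : (_ : Fin k → Bool) × ℕ) (v : β) : ℕ :=
  if v ∈ F₀.verts then τ v else m * partNumber M p + τ v

open Classical in
/-- The vertex map of part `p` of a gadget with root pairs `x`: the vertices `s i` are mapped to the
roots `x i (z i)` chosen by `p`, all other vertices to placed vertices. -/
noncomputable def gadgetMap {α β : Type*} [DecidableEq β] {r k : ℕ} (F₀ : RGraph r β) (τ : β → ℕ)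
    (m M : ℕ) (x : Fin k → Bool → α) (s : Fin k → β) (u : ℕ → α)
    (p : (_ : Fin k → Bool) × ℕ) (v : β) : α :=
  if h : ∃ i, s i = v then x h.choose (p.1 h.choose) else u (gadgetSlot F₀ τ m M p v)

lemma gadgetMap_root {α β : Type*} [DecidableEq β] {r k : ℕ}
    {F₀ : RGraph r β} {τ : β → ℕ} {m M : ℕ} {x : Fin k → Bool → α} {s : Fin k → β} {u : ℕ → α}
    (hs : Function.Injective s) (p : (_ : Fin k → Bool) × ℕ) (i : Fin k) :
    gadgetMap F₀ τ m M x s u p (s i) = x i (p.1 i) := by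
  have h : ∃ j, s j = s i := ⟨i, rfl⟩
  unfold gadgetMap
  rw [dif_pos h, hs h.choose_spec]

lemma gadgetMap_of_notMem {α β : Type*} [DecidableEq β] {r k : ℕ}
    {F₀ : RGraph r β} {τ : β → ℕ} {m M : ℕ} {x : Fin k → Bool → α} {s : Fin k → β} {u : ℕ → α}
    {v : β} (hv : v ∉ Set.range s) (p : (_ : Fin k → Bool) × ℕ) :
    gadgetMap F₀ τ m M x s u p v = u (gadgetSlot F₀ τ m M p v) :=
  dif_neg hv

section
variable {α β δ : Type*} [DecidableEq α] [DecidableEq β] {r k : ℕ}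

/-- The candidates for the `i`-th placed vertex: if it is the last vertex of images of edges of
`Fs` outside `F₀`, then it has to complete all of them to edges of `G`. -/
noncomputable def gadgetCand (G : RGraph r α) (Fs F₀ : RGraph r β) (τ : β → ℕ) (m M : ℕ)
    (x : Fin k → Bool → α) (s : Fin k → β) (i : ℕ) (u : ℕ → α) : Finset α :=
  open Classical in
  G.commonNeighbors {S ∈ G.verts.powersetCard (r - 1) | ∃ p ∈ gadgetIndex k M,
    ∃ e ∈ Fs.edges \ F₀.edges, ∃ v ∈ e, v ∉ F₀.verts ∧ gadgetSlot F₀ τ m M p v = i ∧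
      (∀ w ∈ e, w ∉ F₀.verts → τ w ≤ τ v) ∧ S = (e.erase v).image (gadgetMap F₀ τ m M x s u p)}

variable {F₀ Fs : RGraph r β} {τ : β → ℕ} {m M : ℕ} {x : Fin k → Bool → α} {s : Fin k → β}
  {u : ℕ → α}

variable (hM : 1 ≤ M) (hs : Function.Injective s) (hsF₀ : ∀ i, s i ∈ F₀.verts)
  (hτ : Set.InjOn τ Fs.verts) (hτm : ∀ v ∈ Fs.verts, τ v < m)

include hτ hτm in
lemma eq_of_gadgetSlot_eq {p q : (_ : Fin k → Bool) × ℕ} {v w : β} (hv : v ∈ Fs.verts)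
    (hw : w ∈ Fs.verts) (h : gadgetSlot F₀ τ m M p v = gadgetSlot F₀ τ m M q w) : v = w := by
  have key : ∀ p : (_ : Fin k → Bool) × ℕ, ∀ v ∈ Fs.verts, gadgetSlot F₀ τ m M p v % m = τ v := by
    intro p v hv
    unfold gadgetSlot
    split_ifs
    · exact Nat.mod_eq_of_lt (hτm v hv)
    · rw [Nat.mul_add_mod, Nat.mod_eq_of_lt (hτm v hv)]
  refine hτ hv hw ?_
  rw [← key p v hv, ← key q w hw, h]

include hM hτ hτm in
lemma gadgetSlot_cross {p q : (_ : Fin k → Bool) × ℕ} (hp : p ∈ gadgetIndex k M)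
    (hq : q ∈ gadgetIndex k M) {v w : β} (hv : v ∈ Fs.verts) (hw : w ∈ Fs.verts)
    (h : gadgetSlot F₀ τ m M p v = gadgetSlot F₀ τ m M q w) (hvF₀ : v ∉ F₀.verts) : p = q := by
  have := eq_of_gadgetSlot_eq hτ hτm hv hw h
  subst this
  unfold gadgetSlot at h
  rw [if_neg hvF₀, if_neg hvF₀] at h
  have hm : 0 < m := (Nat.zero_le _).trans_lt (hτm v hv)
  exact partNumber_inj hM hp hq (Nat.eq_of_mul_eq_mul_left hm (by omega))

include hM hτm in
lemma gadgetSlot_lt {p : (_ : Fin k → Bool) × ℕ} (hp : p ∈ gadgetIndex k M) {v : β}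
    (hv : v ∈ Fs.verts) {L : ℕ} (hL : m * (1 + 2 ^ k * M) ≤ L) : gadgetSlot F₀ τ m M p v < L := by
  refine lt_of_lt_of_le ?_ hL
  have h1 := hτm v hv
  have h2 := Nat.mul_le_mul_left m (partNumber_le hM hp)
  rw [mul_add, mul_one]
  unfold gadgetSlot
  split_ifs <;> omega

include hM hτ hτm in
/-- A placed vertex completes the images of at most `(m - 1).choose (r - 1)` edges, because all of
these belong to the same part and contain the same vertex of `Fs`. -/
lemma card_gadgetCand {G : RGraph r α} {c : ℝ} (hm : Fs.verts.card = m)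
    (hG : ∀ A ⊆ G.verts.powersetCard (r - 1), A.card ≤ (m - 1).choose (r - 1) →
      c ≤ (G.commonNeighbors A).card) (i : ℕ) (u : ℕ → α) :
    c ≤ (gadgetCand G Fs F₀ τ m M x s i u).card := by
  classical
  refine hG _ (filter_subset _ _) ?_
  by_cases h : ∃ p ∈ gadgetIndex k M, ∃ v ∈ Fs.verts, v ∉ F₀.verts ∧ gadgetSlot F₀ τ m M p v = i
  · obtain ⟨p, hp, v, hv, hvF₀, rfl⟩ := h
    rw [show (m - 1).choose (r - 1) = ((Fs.verts.erase v).powersetCard (r - 1)).card by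
      rw [card_powersetCard, card_erase_of_mem hv, hm]]
    refine le_trans (card_le_card ?_) (card_image_le (f := image (gadgetMap F₀ τ m M x s u p)))
    intro S hS
    obtain ⟨-, q, hq, e, he, w, hw, hwF₀, hslot, -, rfl⟩ := mem_filter.1 hS
    have heF := (mem_sdiff.1 he).1
    have hwF := Fs.subset_verts e heF hw
    have h1 := gadgetSlot_cross hM hτ hτm hq hp hwF hv hslot hwF₀
    have h2 := eq_of_gadgetSlot_eq hτ hτm hwF hv hslot
    subst h1 h2
    refine mem_image_of_mem _
      (mem_powersetCard.2 ⟨erase_subset_erase _ (Fs.subset_verts e heF), ?_⟩)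
    rw [card_erase_of_mem hw, Fs.card_eq e heF]
  · rw [card_eq_zero.2]
    · exact Nat.zero_le _
    · refine filter_eq_empty_iff.2 ?_
      rintro S - ⟨q, hq, e, he, w, hw, hwF₀, hslot, -⟩
      exact h ⟨q, hq, w, Fs.subset_verts e (mem_sdiff.1 he).1 hw, hwF₀, hslot⟩

include hτ hτm in
/-- The candidates for a vertex depend on the vertices placed earlier only. -/
lemma gadgetCand_congr (G : RGraph r α) {i : ℕ} {u u' : ℕ → α} (h : ∀ j < i, u j = u' j) :
    gadgetCand G Fs F₀ τ m M x s i u = gadgetCand G Fs F₀ τ m M x s i u' := by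
  unfold gadgetCand
  congr 1
  refine filter_congr fun S _ => exists_congr fun p => and_congr_right fun hp =>
    exists_congr fun e => and_congr_right fun he => exists_congr fun v =>
    and_congr_right fun hv => and_congr_right fun hvF₀ => and_congr_right fun hslot =>
    and_congr_right fun hmax => ?_
  have heF := Fs.subset_verts e (mem_sdiff.1 he).1
  have : (e.erase v).image (gadgetMap F₀ τ m M x s u p) =
      (e.erase v).image (gadgetMap F₀ τ m M x s u' p) := by
    refine image_congr fun w hw => ?_
    obtain ⟨hwv, hw⟩ := mem_erase.1 hw
    by_cases hws : w ∈ Set.range s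
    · obtain ⟨j, hj⟩ := hws
      unfold gadgetMap
      rw [dif_pos ⟨j, hj⟩, dif_pos ⟨j, hj⟩]
    · rw [gadgetMap_of_notMem hws, gadgetMap_of_notMem hws]
      refine h _ ?_
      rw [← hslot]
      unfold gadgetSlot
      rw [if_neg hvF₀]
      have h1 := hτm w (heF hw)
      split_ifs with hwF₀
      · have : m ≤ m * partNumber M p := Nat.le_mul_of_pos_right _ (by unfold partNumber; omega)
        omega
      · have h2 := hmax w hw hwF₀
        have h3 : τ w ≠ τ v := fun h => hwv (hτ (heF hw) (heF hv) h)
        omega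
  rw [this]

variable (hx : Function.Injective fun p : Fin k × Bool => x p.1 p.2) {L : ℕ}
  (hL : m * (1 + 2 ^ k * M) ≤ L)
  (hux : ∀ j < L, ∀ i b, u j ≠ x i b) (hu : ∀ j < L, u j ∉ placed u j)

include hu in
lemma eq_of_placed_eq {i j : ℕ} (hi : i < L) (hj : j < L) (h : u i = u j) : i = j := by
  rcases lt_trichotomy i j with hij | hij | hij
  · exact absurd (mem_placed.2 ⟨i, hij, h⟩) (hu j hj)
  · exact hij
  · exact absurd (mem_placed.2 ⟨j, hij, h.symm⟩) (hu i hi)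

include hM hs hτ hτm hx hL hux hu in
lemma gadgetMap_injOn {p : (_ : Fin k → Bool) × ℕ} (hp : p ∈ gadgetIndex k M) :
    Set.InjOn (gadgetMap F₀ τ m M x s u p) Fs.verts := by
  intro v hv w hw h
  have hvL := gadgetSlot_lt (F₀ := F₀) hM hτm hp hv hL
  have hwL := gadgetSlot_lt (F₀ := F₀) hM hτm hp hw hL
  by_cases hvs : v ∈ Set.range s <;> by_cases hws : w ∈ Set.range s
  · obtain ⟨i, rfl⟩ := hvs
    obtain ⟨j, rfl⟩ := hws
    rw [gadgetMap_root hs, gadgetMap_root hs] at h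
    exact congrArg s (congrArg Prod.fst (@hx (i, p.1 i) (j, p.1 j) h))
  · obtain ⟨i, rfl⟩ := hvs
    rw [gadgetMap_root hs, gadgetMap_of_notMem hws] at h
    exact absurd h.symm (hux _ hwL _ _)
  · obtain ⟨i, rfl⟩ := hws
    rw [gadgetMap_root hs, gadgetMap_of_notMem hvs] at h
    exact absurd h (hux _ hvL _ _)
  · rw [gadgetMap_of_notMem hvs, gadgetMap_of_notMem hws] at h
    exact eq_of_gadgetSlot_eq hτ hτm hv hw (eq_of_placed_eq hu hvL hwL h)

include hM hs hsF₀ hτ hτm hL hux hu in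
/-- Different parts of a gadget share images of vertices of `F₀` only. -/
lemma gadgetMap_cross {p q : (_ : Fin k → Bool) × ℕ} (hp : p ∈ gadgetIndex k M)
    (hq : q ∈ gadgetIndex k M) (hpq : p ≠ q) {v w : β} (hv : v ∈ Fs.verts) (hw : w ∈ Fs.verts)
    (h : gadgetMap F₀ τ m M x s u p v = gadgetMap F₀ τ m M x s u q w) : v ∈ F₀.verts := by
  by_contra hvF₀
  have hvs : v ∉ Set.range s := by
    rintro ⟨i, rfl⟩; exact hvF₀ (hsF₀ i)
  have hvL := gadgetSlot_lt (F₀ := F₀) hM hτm hp hv hL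
  have hwL := gadgetSlot_lt (F₀ := F₀) hM hτm hq hw hL
  rw [gadgetMap_of_notMem hvs] at h
  by_cases hws : w ∈ Set.range s
  · obtain ⟨i, rfl⟩ := hws
    rw [gadgetMap_root hs] at h
    exact hux _ hvL _ _ h
  · rw [gadgetMap_of_notMem hws] at h
    exact hpq (gadgetSlot_cross hM hτ hτm hp hq hv hw (eq_of_placed_eq hu hvL hwL h) hvF₀)

include hM hs hτm hL in
lemma image_gadgetMap_subset {p : (_ : Fin k → Bool) × ℕ} (hp : p ∈ gadgetIndex k M) :
    Fs.verts.image (gadgetMap F₀ τ m M x s u p) ⊆ transversal x p.1 ∪ placed u L := by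
  refine image_subset_iff.2 fun v hv => ?_
  by_cases hvs : v ∈ Set.range s
  · obtain ⟨i, rfl⟩ := hvs
    rw [gadgetMap_root hs]
    exact mem_union_left _ (mem_image_of_mem _ (mem_univ i))
  · rw [gadgetMap_of_notMem hvs]
    exact mem_union_right _ (mem_placed.2 ⟨_, gadgetSlot_lt hM hτm hp hv hL, rfl⟩)

include hM hs hsF₀ hτ hτm hx hL hux hu in
lemma gadgetEdges_subset {F : RGraph r δ} {𝓕 : Finset (RGraph r β)}
    (h𝓕 : RGraph.IsDecomposition F Fs 𝓕) (hsep : RGraph.IsWellSeparated 1 𝓕) (hF₀ : F₀ ∈ 𝓕)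
    {G : RGraph r α} (hxG : ∀ i b, x i b ∈ G.verts) (huG : ∀ j < L, u j ∈ G.verts)
    (hcand : ∀ j < L, u j ∈ gadgetCand G Fs F₀ τ m M x s j u) :
    gadgetEdges Fs F₀ (gadgetIndex k M) (gadgetMap F₀ τ m M x s u) ⊆ G.edges := by
  intro e' he'
  obtain ⟨p, hp, he'⟩ := mem_biUnion.1 he'
  obtain ⟨e, he, rfl⟩ := mem_image.1 he'
  have heF := (mem_sdiff.1 he).1
  have heV := Fs.subset_verts e heF
  -- the last vertex of `e` outside `F₀` completes the image of `e`
  have hne : (e \ F₀.verts).Nonempty := by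
    rw [nonempty_iff_ne_empty, Ne, sdiff_eq_empty_iff_subset]
    exact h𝓕.not_subset_verts hsep hF₀ he
  obtain ⟨v, hv, hmax⟩ := exists_max_image _ τ hne
  obtain ⟨hve, hvF₀⟩ := mem_sdiff.1 hv
  have hvL := gadgetSlot_lt (F₀ := F₀) hM hτm hp (heV hve) hL
  have hinj := gadgetMap_injOn (F₀ := F₀) hM hs hτ hτm hx hL hux hu hp
  have hGV : ∀ w ∈ Fs.verts, gadgetMap F₀ τ m M x s u p w ∈ G.verts := by
    intro w hw
    rcases mem_union.1 (image_gadgetMap_subset (F₀ := F₀) (u := u) (x := x) hM hs hτm hL hp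
      (mem_image_of_mem _ hw)) with h | h
    · obtain ⟨i, -, hi⟩ := mem_image.1 h
      rw [← hi]; exact hxG _ _
    · obtain ⟨j, hj, hj'⟩ := mem_placed.1 h
      rw [← hj']; exact huG j hj
  have h1 := hcand _ hvL
  unfold gadgetCand RGraph.commonNeighbors at h1
  have h2 := (mem_filter.1 h1).2 ((e.erase v).image (gadgetMap F₀ τ m M x s u p)) (by
    refine mem_filter.2 ⟨mem_powersetCard.2 ⟨?_, ?_⟩, p, hp, e, he, v, hve, hvF₀, rfl, ?_, rfl⟩
    · exact image_subset_iff.2 fun w hw => hGV w (heV (mem_of_mem_erase hw))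
    · rw [card_image_of_injOn (hinj.mono (coe_subset.2 ((erase_subset _ _).trans heV))),
        card_erase_of_mem hve, Fs.card_eq e heF]
    · exact fun w hw hwF₀ => hmax w (mem_sdiff.2 ⟨hw, hwF₀⟩))
  have h3 := (mem_filter.1 h2).2
  have hvs : v ∉ Set.range s := by
    rintro ⟨i, rfl⟩; exact hvF₀ (hsF₀ i)
  rw [← gadgetMap_of_notMem (x := x) (u := u) (F₀ := F₀) hvs p, ← image_singleton,
    ← image_union] at h3
  rwa [show e.erase v ∪ {v} = e by
    rw [union_comm, ← insert_eq, insert_erase hve]] at h3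

include hM hs hsF₀ hτ hτm hx hL hux hu in
/-- The degree condition of gadgets, for the explicit vertex maps `gadgetMap`. -/
lemma divDegree_dvd_degree_gadget_sub {F : RGraph r δ} {𝓕 : Finset (RGraph r β)}
    (h𝓕 : RGraph.IsDecomposition F Fs 𝓕) (hsep : RGraph.IsWellSeparated 1 𝓕) (hF₀ : F₀ ∈ 𝓕)
    {S : Finset α} (hS : S.card ≤ k) (hdvd : Fs.divDegree S.card ∣ M) :
    (Fs.divDegree S.card : ℤ) ∣
      degree (gadgetEdges Fs F₀ (gadgetIndex k M) (gadgetMap F₀ τ m M x s u)) S -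
        octahedron x S * degree F₀.edges (univ.image s) := by
  have hF₀V : F₀.verts ⊆ Fs.verts := (h𝓕.1.1 F₀ hF₀).2.1
  have hslot : ∀ p : (_ : Fin k → Bool) × ℕ, ∀ v ∈ F₀.verts, gadgetSlot F₀ τ m M p v = τ v :=
    fun p v hv => if_pos hv
  have hτL : ∀ v ∈ F₀.verts, τ v < L := by
    intro v hv
    have := hτm v (hF₀V hv)
    have : m ≤ m * (1 + 2 ^ k * M) := Nat.le_mul_of_pos_right _ (by omega)
    omega
  refine divDegree_dvd_degree_gadgetEdges_sub h𝓕 hsep hF₀ hM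
    (fun p hp => gadgetMap_injOn hM hs hτ hτm hx hL hux hu hp)
    (fun p hp q hq hpq v hv w hw h =>
      gadgetMap_cross hM hs hsF₀ hτ hτm hL hux hu hp hq hpq hv hw h) hx (s := s)
    (θ₀ := fun z => gadgetMap F₀ τ m M x s u ⟨z, 0⟩) ?_ ?_ ?_ ?_ ?_ hS hdvd
  · intro p v hv
    by_cases hvs : v ∈ Set.range s
    · obtain ⟨i, rfl⟩ := hvs
      rw [gadgetMap_root hs, gadgetMap_root hs]
    · rw [gadgetMap_of_notMem hvs, gadgetMap_of_notMem hvs, hslot _ v hv, hslot _ v hv]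
  · intro z v hv w hw h
    by_cases hvs : v ∈ Set.range s <;> by_cases hws : w ∈ Set.range s
    · obtain ⟨i, rfl⟩ := hvs
      obtain ⟨j, rfl⟩ := hws
      rw [gadgetMap_root hs, gadgetMap_root hs] at h
      exact congrArg s (congrArg Prod.fst (@hx (i, z i) (j, z j) h))
    · obtain ⟨i, rfl⟩ := hvs
      rw [gadgetMap_root hs, gadgetMap_of_notMem hws, hslot _ w hw] at h
      exact absurd h.symm (hux _ (hτL w hw) _ _)
    · obtain ⟨i, rfl⟩ := hws
      rw [gadgetMap_root hs, gadgetMap_of_notMem hvs, hslot _ v hv] at h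
      exact absurd h (hux _ (hτL v hv) _ _)
    · rw [gadgetMap_of_notMem hvs, gadgetMap_of_notMem hws, hslot _ v hv, hslot _ w hw] at h
      exact hτ (hF₀V hv) (hF₀V hw) (eq_of_placed_eq hu (hτL v hv) (hτL w hw) h)
  · intro z i
    exact gadgetMap_root hs _ _
  · intro z z' v hv hvs
    rw [gadgetMap_of_notMem hvs, gadgetMap_of_notMem hvs, hslot _ v hv, hslot _ v hv]
  · intro z v hv hvs i b
    rw [gadgetMap_of_notMem hvs, hslot _ v hv]
    exact hux _ (hτL v hv) i b

end

/-! ### Correcting degrees by a selection of gadgets -/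

/-- The data of a gadget: its dimension `k`, its root pairs, the `k` vertices of `F₀` that are
mapped to the roots, and a number that distinguishes duplicates. -/
abbrev GadgetLabel (α β : Type*) := Σ k, (Fin k → Bool → α) × (Fin k → β) × ℕ

/-- The transversals of the root pairs of a gadget. -/
def rootSets {α β : Type*} [DecidableEq α] (t : GadgetLabel α β) : Finset (Finset α) :=
  univ.image (transversal t.2.1)

/-- The index set of all gadgets: a gadget of dimension `k < r` is given by an octahedron in `Q k`,
an injection of its coordinates into the vertices of `F₀`, and the number of a duplicate. -/
def gadgetFamily {α β : Type*} [DecidableEq β] (Q : ∀ k, Finset (Fin k → Bool → α))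
    (W : Finset β) (r M : ℕ) : Finset (GadgetLabel α β) :=
  (range r).sigma fun k =>
    Q k ×ˢ {s ∈ Fintype.piFinset fun _ : Fin k => W | Function.Injective s} ×ˢ range M

lemma mem_gadgetFamily {α β : Type*} [DecidableEq β] {Q : ∀ k, Finset (Fin k → Bool → α)}
    {W : Finset β} {r M k : ℕ} {x : Fin k → Bool → α} {s : Fin k → β} {c : ℕ} :
    (⟨k, x, s, c⟩ : GadgetLabel α β) ∈ gadgetFamily Q W r M ↔
      k < r ∧ x ∈ Q k ∧ ((∀ i, s i ∈ W) ∧ Function.Injective s) ∧ c < M := by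
  simp [gadgetFamily, and_assoc]

/-- One dimension of the degree correction: the defect at the `k`-sets is a combination of
octahedra whose coefficients are multiples of `d`, and `d` is a combination of the weights `w s`
of the available gadgets. As only the residue modulo `m` matters, at most `M ≥ m` duplicates of each
gadget are needed. -/
lemma exists_selection_step {α β : Type*} [DecidableEq α] {V : Finset α} {k m d M : ℕ}
    (Q : Finset (Fin k → Bool → α)) (Ss : Finset (Fin k → β)) (w a : (Fin k → β) → ℤ)
    (hQ : ∀ {A : Type} [AddCommGroup A] (f : Finset α → A),
      (∀ T ⊆ V, T.card < k → ∑ S ∈ V.powersetCard k with T ⊆ S, f S = 0) →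
      ∃ c : (Fin k → Bool → α) → A, ∀ S ∈ V.powersetCard k,
        f S = ∑ x ∈ Q, octahedron x S • c x)
    (hm : 0 < m) (hmM : m ≤ M) (ha : (d : ℤ) = ∑ s ∈ Ss, a s * w s) (h : Finset α → ℕ)
    (hsum : ∀ T ⊆ V, T.card < k → m ∣ ∑ S ∈ V.powersetCard k with T ⊆ S, h S)
    (hd : ∀ S ∈ V.powersetCard k, d ∣ h S) :
    ∃ b : (Fin k → Bool → α) → (Fin k → β) → ℕ, (∀ x s, b x s ≤ M) ∧ ∀ S ∈ V.powersetCard k,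
      (m : ℤ) ∣ h S + ∑ x ∈ Q, ∑ s ∈ Ss, b x s * (octahedron x S * w s) := by
  have : NeZero m := ⟨hm.ne'⟩
  -- coefficients are taken in the multiples of `d` modulo `m`, so that each of them can be realised
  -- by gadgets
  let B := AddSubgroup.zmultiples (d : ZMod m)
  let gen : B := ⟨d, AddSubgroup.mem_zmultiples _⟩
  have hval : ∀ S ∈ V.powersetCard k, (((h S / d) • gen : B) : ZMod m) = h S := by
    intro S hS
    rw [AddSubgroup.coe_nsmul, nsmul_eq_mul]
    simp only [gen]
    rw [← Nat.cast_mul, Nat.div_mul_cancel (hd S hS)]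
  obtain ⟨c, hc⟩ := hQ (A := B) (fun S => (h S / d) • gen) (by
    intro T hT hTk
    apply Subtype.ext
    rw [AddSubgroup.val_finsetSum, sum_congr rfl fun S hS => hval S (mem_filter.1 hS).1,
      ← Nat.cast_sum]
    exact (ZMod.natCast_eq_zero_iff _ _).2 (hsum T hT hTk))
  have hc' : ∀ x, ∃ n : ℤ, (c x : ZMod m) = n * d := by
    intro x
    obtain ⟨n, hn⟩ := AddSubgroup.mem_zmultiples_iff.1 (c x).2
    exact ⟨n, by rw [← hn, zsmul_eq_mul]⟩
  choose n hn using hc'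
  refine ⟨fun x s => (-(n x * a s : ℤ) : ZMod m).val, fun x s => (ZMod.val_lt _).le.trans hmM, ?_⟩
  intro S hS
  rw [← ZMod.intCast_zmod_eq_zero_iff_dvd]
  push_cast
  have h1 := congrArg (Subtype.val) (hc S hS)
  rw [hval S hS, AddSubgroup.val_finsetSum] at h1
  rw [h1, ← sum_add_distrib]
  refine sum_eq_zero fun x _ => ?_
  have h2 : ((d : ℤ) : ZMod m) = ((∑ s ∈ Ss, a s * w s : ℤ) : ZMod m) := by rw [ha]
  push_cast at h2
  rw [AddSubgroup.coe_zsmul, hn, zsmul_eq_mul, h2, mul_sum, mul_sum, ← sum_add_distrib]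
  refine sum_eq_zero fun s _ => ?_
  rw [ZMod.natCast_zmod_val]
  ring

/-- Any degree function that is compatible with the divisibility conditions can be corrected,
dimension by dimension, by a suitable selection of gadgets. Here `h` and `g t` are the degree
functions of the given graph and of the gadgets, `d` stands for `Deg(F)` and `m` for `Deg(Fs)`.
A gadget of dimension `k` does not disturb the divisibility at smaller sets that was achieved
before. -/
lemma exists_selection {α β : Type*} [DecidableEq α] [DecidableEq β] {V : Finset α} {r M : ℕ}
    {m d : ℕ → ℕ} (Q : ∀ k, Finset (Fin k → Bool → α)) (W : Finset β)
    (w : ∀ k, (Fin k → β) → ℤ)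
    (hQinj : ∀ k, ∀ x ∈ Q k, Function.Injective fun p : Fin k × Bool => x p.1 p.2)
    (hQ : ∀ k, ∀ {A : Type} [AddCommGroup A] (f : Finset α → A),
      (∀ T ⊆ V, T.card < k → ∑ S ∈ V.powersetCard k with T ⊆ S, f S = 0) →
      ∃ c : (Fin k → Bool → α) → A, ∀ S ∈ V.powersetCard k,
        f S = ∑ x ∈ Q k, octahedron x S • c x)
    (hm : ∀ k < r, 0 < m k ∧ m k ≤ M)
    (hchoose : ∀ i k, i ≤ k → m k ∣ (r - i).choose (k - i) * m i)
    (hd : ∀ k < r, ∃ a : (Fin k → β) → ℤ, (d k : ℤ) =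
      ∑ s ∈ Fintype.piFinset fun _ : Fin k => W with Function.Injective s, a s * w k s)
    (h : Finset α → ℕ) (g : GadgetLabel α β → Finset α → ℕ)
    (hsum : ∀ k T, T.card ≤ k →
      ∑ S ∈ V.powersetCard k with T ⊆ S, h S = (r - T.card).choose (k - T.card) * h T)
    (hgsum : ∀ t ∈ gadgetFamily Q W r M, ∀ k T, T.card ≤ k →
      ∑ S ∈ V.powersetCard k with T ⊆ S, g t S = (r - T.card).choose (k - T.card) * g t T)
    (hhd : ∀ S ⊆ V, S.card < r → d S.card ∣ h S)
    (hgd : ∀ t ∈ gadgetFamily Q W r M, ∀ S, d S.card ∣ g t S)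
    (hg : ∀ t ∈ gadgetFamily Q W r M, ∀ S : Finset α, S.card ≤ t.1 →
      (m S.card : ℤ) ∣ g t S - octahedron t.2.1 S * w t.1 t.2.2.1) :
    ∃ J ⊆ gadgetFamily Q W r M, ∀ S ⊆ V, S.card < r → m S.card ∣ h S + ∑ t ∈ J, g t S := by
  classical
  suffices H : ∀ k ≤ r, ∃ J ⊆ gadgetFamily Q W r M, (∀ t ∈ J, t.1 < k) ∧
      ∀ S ⊆ V, S.card < k → m S.card ∣ h S + ∑ t ∈ J, g t S by
    obtain ⟨J, h1, -, h2⟩ := H r le_rfl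
    exact ⟨J, h1, h2⟩
  intro k
  induction k with
  | zero => exact fun _ => ⟨∅, by simp, by simp, by simp⟩
  | succ k ih =>
    intro hk
    obtain ⟨J, hJ, hJk, hJS⟩ := ih (by omega)
    obtain ⟨a, ha⟩ := hd k (by omega)
    set Ss := (Fintype.piFinset fun _ : Fin k => W).filter fun s => Function.Injective s with hSs
    obtain ⟨b, hbM, hb⟩ := exists_selection_step (V := V) (Q k) Ss (w k) a (hQ k)
      (hm k (by omega)).1 (hm k (by omega)).2 ha (fun S => h S + ∑ t ∈ J, g t S) (by
        intro T hT hTk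
        have h1 : ∑ S ∈ V.powersetCard k with T ⊆ S, (h S + ∑ t ∈ J, g t S) =
            (r - T.card).choose (k - T.card) * (h T + ∑ t ∈ J, g t T) := by
          rw [sum_add_distrib, hsum k T hTk.le, sum_comm, mul_add, mul_sum]
          congr 1
          exact sum_congr rfl fun t ht => hgsum t (hJ ht) k T hTk.le
        rw [h1]
        exact (hchoose _ k hTk.le).trans (mul_dvd_mul_left _ (hJS T hT hTk))) (by
        intro S hS
        obtain ⟨hSV, rfl⟩ := mem_powersetCard.1 hS
        exact dvd_add (hhd S hSV (by omega)) (dvd_sum fun t ht => hgd t (hJ ht) S))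
    let J' : Finset (GadgetLabel α β) :=
      ((Q k).sigma fun x => Ss.sigma fun s => range (b x s)).map
        ⟨fun p => ⟨k, p.1, p.2.1, p.2.2⟩, by
          rintro ⟨x, s, c⟩ ⟨x', s', c'⟩ hp
          simp only [Sigma.mk.injEq, heq_eq_eq, Prod.mk.injEq, true_and] at hp
          obtain ⟨rfl, rfl, rfl⟩ := hp
          rfl⟩
    have hJ'mem : ∀ t ∈ J', ∃ x ∈ Q k, ∃ s ∈ Ss, ∃ c < b x s, t = ⟨k, x, s, c⟩ := by
      intro t ht
      obtain ⟨⟨x, s, c⟩, hp, rfl⟩ := mem_map.1 ht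
      simp only [mem_sigma, mem_range] at hp
      exact ⟨x, hp.1, s, hp.2.1, c, hp.2.2, rfl⟩
    have hJ'sub : J' ⊆ gadgetFamily Q W r M := by
      intro t ht
      obtain ⟨x, hx, s, hs, c, hc, rfl⟩ := hJ'mem t ht
      rw [hSs, mem_filter, Fintype.mem_piFinset] at hs
      exact mem_gadgetFamily.2 ⟨by omega, hx, hs, hc.trans_le (hbM x s)⟩
    have hdisj : Disjoint J J' := by
      rw [disjoint_left]
      intro t ht ht'
      obtain ⟨x, hx, s, hs, c, hc, rfl⟩ := hJ'mem t ht'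
      exact lt_irrefl _ (hJk _ ht)
    refine ⟨J ∪ J', union_subset hJ hJ'sub, ?_, ?_⟩
    · intro t ht
      rcases mem_union.1 ht with ht | ht
      · exact (hJk t ht).trans (Nat.lt_succ_self k)
      · obtain ⟨x, hx, s, hs, c, hc, rfl⟩ := hJ'mem t ht
        exact Nat.lt_succ_self k
    · intro S hS hSk
      rw [sum_union hdisj, ← add_assoc]
      rcases Nat.lt_succ_iff_lt_or_eq.1 hSk with hSk | hSk
      · refine dvd_add (hJS S hS hSk) (dvd_sum fun t ht => ?_)
        have h1 := hg t (hJ'sub ht) S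
        obtain ⟨x, hx, s, hs, c, hc, rfl⟩ := hJ'mem t ht
        have h2 := h1 hSk.le
        rw [octahedron_eq_zero, zero_mul, sub_zero] at h2
        · exact Int.natCast_dvd_natCast.1 h2
        · rintro z rfl
          rw [card_transversal (hQinj k x hx)] at hSk
          exact lt_irrefl _ hSk
      · have h1 := hb S (mem_powersetCard.2 ⟨hS, hSk⟩)
        rw [← Int.natCast_dvd_natCast]
        have h2 : (m k : ℤ) ∣ (∑ t ∈ J', g t S : ℕ) -
            ∑ x ∈ Q k, ∑ s ∈ Ss, b x s * (octahedron x S * w k s) := by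
          have h3 : ((∑ t ∈ J', g t S : ℕ) : ℤ) =
              ∑ x ∈ Q k, ∑ s ∈ Ss, ∑ c ∈ range (b x s), (g ⟨k, x, s, c⟩ S : ℤ) := by
            simp only [J', sum_map, sum_sigma]
            push_cast; rfl
          rw [h3, ← sum_sub_distrib]
          refine dvd_sum fun x hx => ?_
          rw [← sum_sub_distrib]
          refine dvd_sum fun s hs => ?_
          rw [← nsmul_eq_mul, ← card_range (b x s), ← sum_const, card_range, ← sum_sub_distrib]
          refine dvd_sum fun c hc => ?_
          have hmem : (⟨k, x, s, c⟩ : GadgetLabel α β) ∈ J' :=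
            mem_map.2 ⟨⟨x, s, c⟩, by simp only [mem_sigma]; exact ⟨hx, hs, hc⟩, rfl⟩
          have := hg _ (hJ'sub hmem) S hSk.le
          rwa [hSk] at this
        rw [hSk]
        have h4 := dvd_add h1 h2
        rw [add_add_sub_cancel] at h4
        exact_mod_cast h4

/-! ### Placing all gadgets -/

/-- Each multiple of the greatest common divisor of the degrees of `F₀` at its `k`-sets is an
integer combination of these degrees; the `k`-sets are listed by the injective
maps `Fin k → F₀.verts`. -/
lemma RGraph.exists_divDegree_eq_sum {β : Type*} [DecidableEq β] {r : ℕ} (F₀ : RGraph r β)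
    {k d : ℕ} (hd : F₀.divDegree k ∣ d) :
    ∃ a : (Fin k → β) → ℤ, (d : ℤ) =
      ∑ s ∈ Fintype.piFinset fun _ : Fin k => F₀.verts with Function.Injective s,
        a s * degree F₀.edges (univ.image s) := by
  set Ss := (Fintype.piFinset fun _ : Fin k => F₀.verts).filter fun s => Function.Injective s
    with hSs
  obtain ⟨b, hb⟩ := Finset.gcd_eq_sum_mul Ss fun s => (degree F₀.edges (univ.image s) : ℤ)
  have h1 : Ss.gcd (fun s => (degree F₀.edges (univ.image s) : ℤ)) ∣ (d : ℤ) := by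
    refine dvd_trans ?_ (Int.natCast_dvd_natCast.2 hd)
    rw [← Int.dvd_natAbs, ← Int.natAbs_dvd, Int.natCast_dvd_natCast, Int.natAbs_natCast]
    refine dvd_gcd fun S hS => ?_
    obtain ⟨hSV, hSk⟩ := mem_powersetCard.1 hS
    let s : Fin k → β := fun i => S.equivFinOfCardEq hSk |>.symm i
    have hsS : univ.image s = S := by
      ext v
      simp only [s, mem_image, mem_univ, true_and]
      constructor
      · rintro ⟨i, rfl⟩; exact Subtype.prop _
      · exact fun hv => ⟨S.equivFinOfCardEq hSk ⟨v, hv⟩, by simp⟩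
    have hs : s ∈ Ss := by
      rw [hSs, mem_filter, Fintype.mem_piFinset]
      refine ⟨fun i => hSV (Subtype.prop _), fun i j h => ?_⟩
      exact (S.equivFinOfCardEq hSk).symm.injective (Subtype.ext h)
    have h2 : Ss.gcd (fun s => (degree F₀.edges (univ.image s) : ℤ)) ∣
        (degree F₀.edges (univ.image s) : ℤ) := gcd_dvd hs
    rw [hsS] at h2
    rw [F₀.card_link, ← Int.natCast_dvd_natCast]
    exact Int.natAbs_dvd.2 h2
  obtain ⟨q, hq⟩ := h1
  refine ⟨fun s => q * b s, ?_⟩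
  rw [hq, hb, sum_mul]
  exact sum_congr rfl fun s _ => by ring

section
variable {α β : Type*} [DecidableEq α] [DecidableEq β]

/-- A set `S` of at most `k` vertices lies in at most `n ^ (k - |S|)` sets of `k` vertices, and each
of these is a transversal of boundedly many octahedra. -/
lemma card_gadgetFamily_root_le {V : Finset α} {Q : ∀ k, Finset (Fin k → Bool → α)} {C : ℕ → ℕ}
    {W : Finset β} {r M f : ℕ} (hV : V.Nonempty) (hWf : W.card ≤ f) (hrf : r ≤ f)
    (hQV : ∀ k, ∀ x ∈ Q k, ∀ i b, x i b ∈ V)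
    (hQinj : ∀ k, ∀ x ∈ Q k, Function.Injective fun p : Fin k × Bool => x p.1 p.2)
    (hQ : ∀ k S, #{x ∈ Q k | ∃ z, S = transversal x z} ≤ C k) {S : Finset α}
    (hS : S.card + 1 ≤ r) :
    #{t ∈ gadgetFamily Q W r M | ∃ B ∈ (rootSets t : Finset (Finset α)), S ⊆ B} ≤
      ((∑ k ∈ range f, C k) * (f ^ f * M) + 1) * V.card ^ (r - 1 - S.card) := by
  have hn : 1 ≤ V.card := card_pos.2 hV
  have hx : ∀ k < r, #{x ∈ Q k | ∃ z, S ⊆ transversal x z} ≤ V.card ^ (r - 1 - S.card) * C k := by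
    intro k hk
    have hsub : {x ∈ Q k | ∃ z, S ⊆ transversal x z} ⊆
        {S' ∈ V.powersetCard k | S ⊆ S'}.biUnion fun S' =>
          {x ∈ Q k | ∃ z, S' = transversal x z} := by
      intro x hx
      obtain ⟨hx, z, hz⟩ := mem_filter.1 hx
      refine mem_biUnion.2 ⟨transversal x z, mem_filter.2 ⟨mem_powersetCard.2 ⟨?_, ?_⟩, hz⟩,
        mem_filter.2 ⟨hx, z, rfl⟩⟩
      · exact image_subset_iff.2 fun i _ => hQV k x hx _ _
      · exact card_transversal (hQinj k x hx) z
    refine (card_le_card hsub).trans ((card_biUnion_le_card_mul _ _ (C k) fun S' _ => hQ k S').trans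
      (Nat.mul_le_mul_right _ ?_))
    by_cases h : S ⊆ V ∧ S.card ≤ k
    · rw [card_powersetCard_superset h.1 h.2]
      refine (Nat.choose_le_pow _ _).trans ((Nat.pow_le_pow_left (Nat.sub_le _ _) _).trans ?_)
      exact Nat.pow_le_pow_right hn (by omega)
    · rw [card_eq_zero.2]
      · exact Nat.zero_le _
      · refine filter_eq_empty_iff.2 fun S' hS' hSS' => h ?_
        obtain ⟨h1, rfl⟩ := mem_powersetCard.1 hS'
        exact ⟨hSS'.trans h1, card_le_card hSS'⟩
  have hs : ∀ k < r,
      #{s ∈ Fintype.piFinset fun _ : Fin k => W | Function.Injective s} ≤ f ^ f := by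
    intro k hk
    refine (card_filter_le _ _).trans ?_
    rw [Fintype.card_piFinset_const]
    calc W.card ^ k ≤ f ^ k := Nat.pow_le_pow_left hWf _
      _ ≤ f ^ f := Nat.pow_le_pow_right (by omega) (by omega)
  have hsub : {t ∈ gadgetFamily Q W r M | ∃ B ∈ (rootSets t : Finset (Finset α)), S ⊆ B} ⊆
      (range r).sigma fun k => {x ∈ Q k | ∃ z, S ⊆ transversal x z} ×ˢ
        {s ∈ Fintype.piFinset fun _ : Fin k => W | Function.Injective s} ×ˢ range M := by
    rintro ⟨k, x, s, c⟩ ht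
    obtain ⟨ht, B, hB, hSB⟩ := mem_filter.1 ht
    obtain ⟨z, -, rfl⟩ := mem_image.1 hB
    obtain ⟨h1, h2, h3, h4⟩ := mem_gadgetFamily.1 ht
    simp only [mem_sigma, mem_product, mem_filter, mem_range, Fintype.mem_piFinset]
    exact ⟨h1, ⟨h2, z, hSB⟩, h3, h4⟩
  refine (card_le_card hsub).trans ?_
  rw [card_sigma]
  calc _ ≤ ∑ k ∈ range r, C k * (V.card ^ (r - 1 - S.card) * (f ^ f * M)) := by
        refine sum_le_sum fun k hk => ?_
        rw [mem_range] at hk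
        rw [card_product, card_product, card_range]
        refine (Nat.mul_le_mul (hx k hk) (Nat.mul_le_mul_right M (hs k hk))).trans_eq ?_
        ring
    _ ≤ ∑ k ∈ range f, C k * (V.card ^ (r - 1 - S.card) * (f ^ f * M)) :=
        sum_le_sum_of_subset (range_mono hrf)
    _ = (∑ k ∈ range f, C k) * (f ^ f * M) * V.card ^ (r - 1 - S.card) := by
        rw [← sum_mul]; ring
    _ ≤ _ := Nat.mul_le_mul_right _ (Nat.le_succ _)

lemma degree_le_card {r : ℕ} {E : Finset (Finset α)} {X S : Finset α} (hX : ∀ e ∈ E, e ⊆ X)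
    (hr : ∀ e ∈ E, e.card = r) (hS : S.card + 1 = r) : degree E S ≤ X.card := by
  refine (card_le_card (t := X.image fun v => insert v S) fun e he => ?_).trans card_image_le
  obtain ⟨he, hSe⟩ := mem_filter.1 he
  obtain ⟨v, -, rfl⟩ := exists_eq_insert_iff.2 ⟨hSe, by rw [hr e he, hS]⟩
  exact mem_image_of_mem _ (hX _ he (mem_insert_self _ _))

/-- All gadgets can be placed in `G` simultaneously: `E t` is the edge set of the gadget `t`, and
`𝓒 t` is its decomposition into copies of `F`. The copies avoid the edges of `O` and are well
separated, also between different gadgets, and the union of all gadgets has bounded maximum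
degree. -/
lemma exists_gadgets {δ : Type*} [DecidableEq δ] {r f M N C₀ lam : ℕ} {c γ : ℝ} {F : RGraph r δ}
    {Fs F₀ : RGraph r β} {𝓕 : Finset (RGraph r β)} {G : RGraph r α} {O : RGraph (r + 1) α}
    {Q : ∀ k, Finset (Fin k → Bool → α)} {C : ℕ → ℕ}
    (hr : 1 ≤ r) (hrf : r ≤ f) (hM : 1 ≤ M) (hlam : 1 ≤ lam) (hV : G.verts.Nonempty)
    (hγ : 0 ≤ γ) (hFs : Fs.verts.card = f)
    (hMdvd : ∀ i ≤ r, Fs.divDegree i ∣ M)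
    (h𝓕 : RGraph.IsDecomposition F Fs 𝓕) (hsep : RGraph.IsWellSeparated 1 𝓕) (hF₀ : F₀ ∈ 𝓕)
    (hG : ∀ A ⊆ G.verts.powersetCard (r - 1), A.card ≤ (f - 1).choose (r - 1) →
      c ≤ (G.commonNeighbors A).card)
    (hO : ∀ T ⊆ G.verts, T.card = r → (#{v ∈ G.verts | insert v T ∈ O.edges} : ℝ) ≤ γ)
    (hQV : ∀ k, ∀ x ∈ Q k, ∀ i b, x i b ∈ G.verts)
    (hQinj : ∀ k, ∀ x ∈ Q k, Function.Injective fun p : Fin k × Bool => x p.1 p.2)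
    (hQ : ∀ k S, #{x ∈ Q k | ∃ z, S = transversal x z} ≤ C k)
    (hC₀ : C₀ = (∑ k ∈ range f, C k) * (f ^ f * M) + 1)
    (hN : N = 2 * f + f * (1 + 2 ^ f * M))
    (hc : (N : ℝ) + 2 ^ N * (2 * N * G.verts.card / lam + γ + 2 * N * C₀ * lam ^ r) < c) :
    ∃ (E : GadgetLabel α β → Finset (Finset α))
      (𝓒 : GadgetLabel α β → Finset (RGraph r α)),
      (∀ t ∈ gadgetFamily Q F₀.verts r M, E t ⊆ G.edges ∧
        (∀ F' ∈ 𝓒 t, RGraph.IsCopy F F' ∧ F'.verts ⊆ G.verts ∧ F'.edges ⊆ E t ∧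
          ∀ S ⊆ F'.verts, S.card = r + 1 → S ∉ O.edges) ∧
        (∀ e ∈ E t, ∃ F' ∈ 𝓒 t, e ∈ F'.edges) ∧
        (∀ S, F.divDegree S.card ∣ degree (E t) S) ∧
        ∀ S : Finset α, S.card ≤ t.1 → (Fs.divDegree S.card : ℤ) ∣
          degree (E t) S - octahedron t.2.1 S * degree F₀.edges (univ.image t.2.2.1)) ∧
      (∀ t ∈ gadgetFamily Q F₀.verts r M, ∀ t' ∈ gadgetFamily Q F₀.verts r M,
        ∀ F₁ ∈ 𝓒 t, ∀ F₂ ∈ 𝓒 t', F₁ ≠ F₂ → (F₁.verts ∩ F₂.verts).card < r) ∧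
      (∀ t ∈ gadgetFamily Q F₀.verts r M, ∀ t' ∈ gadgetFamily Q F₀.verts r M,
        t ≠ t' → Disjoint (E t) (E t')) ∧
      ∀ S : Finset α, S.card + 1 = r →
        degree ((gadgetFamily Q F₀.verts r M).biUnion E) S ≤ N * (2 * C₀ * lam ^ r) := by
  classical
  set I := gadgetFamily Q F₀.verts r M with hI
  have hF₀V : F₀.verts ⊆ Fs.verts := (h𝓕.1.1 F₀ hF₀).2.1
  -- an enumeration of the vertices of `Fs`
  obtain ⟨τ, hτ, hτf⟩ : ∃ τ : β → ℕ, Set.InjOn τ Fs.verts ∧ ∀ v ∈ Fs.verts, τ v < f := by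
    refine ⟨fun v => if h : v ∈ Fs.verts then Fs.verts.equivFin ⟨v, h⟩ else 0, ?_, ?_⟩
    · intro v hv w hw h
      simp only [mem_coe.1 hv, mem_coe.1 hw, dif_pos] at h
      have := Fs.verts.equivFin.injective (Fin.ext h)
      exact congrArg Subtype.val this
    · intro v hv
      simp only [hv, dif_pos]
      exact (Fin.isLt _).trans_eq hFs
  let L := f * (1 + 2 ^ f * M)
  have hIspec : ∀ t ∈ I, t.1 < r ∧ t.2.1 ∈ Q t.1 ∧ (∀ i, t.2.2.1 i ∈ F₀.verts) ∧
      Function.Injective t.2.2.1 := by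
    rintro ⟨k, x, s, c⟩ ht
    obtain ⟨h1, h2, h3, h4⟩ := mem_gadgetFamily.1 ht
    exact ⟨h1, h2, h3.1, h3.2⟩
  have hroots : ∀ (t : GadgetLabel α β) i b, t.2.1 i b ∈ (rootSets t).sup id := by
    intro t i b
    refine mem_sup.2 ⟨transversal t.2.1 fun _ => b, mem_image_of_mem _ (mem_univ _), ?_⟩
    exact mem_image.2 ⟨i, mem_univ _, rfl⟩
  have h𝓑card : ∀ t ∈ I, ((rootSets t).sup id).card + L ≤ N := by
    intro t ht
    have h1 : (rootSets t).sup id ⊆ univ.image fun p : Fin t.1 × Bool => t.2.1 p.1 p.2 := by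
      refine Finset.sup_le fun B hB => ?_
      obtain ⟨z, -, rfl⟩ := mem_image.1 hB
      exact image_subset_iff.2 fun i _ => mem_image.2 ⟨(i, z i), mem_univ _, rfl⟩
    have h2 := (card_le_card h1).trans card_image_le
    simp only [card_univ, Fintype.card_prod, Fintype.card_fin, Fintype.card_bool] at h2
    have h3 := (hIspec t ht).1
    simp only [L, hN]
    omega
  have h𝓑V : ∀ t ∈ I, ∀ B ∈ rootSets t, B ⊆ G.verts := by
    intro t ht B hB
    obtain ⟨z, -, rfl⟩ := mem_image.1 hB
    exact image_subset_iff.2 fun i _ => hQV _ _ (hIspec t ht).2.1 _ _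
  obtain ⟨u, hu1, hu2, hu3⟩ := exists_placement G.verts r L N C₀ lam c γ I rootSets
    (fun t => gadgetCand G Fs F₀ τ f M t.2.1 t.2.2.1) O.edges hr (by omega) hlam hV hγ h𝓑V
    (by
      intro t ht B hB
      obtain ⟨z, -, rfl⟩ := mem_image.1 hB
      rw [card_transversal (hQinj _ _ (hIspec t ht).2.1)]
      exact (hIspec t ht).1)
    h𝓑card (fun t _ i u u' h => gadgetCand_congr hτ hτf G h)
    (fun t _ i u => filter_subset _ _) (fun t _ i u => card_gadgetCand hM hτ hτf hFs hG i u) hO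
    (fun S hS => by
      rw [hC₀]
      exact card_gadgetFamily_root_le hV ((card_le_card hF₀V).trans_eq hFs) hrf hQV hQinj hQ hS) hc
  have hL : ∀ t ∈ I, f * (1 + 2 ^ t.1 * M) ≤ L := by
    intro t ht
    have := (hIspec t ht).1
    exact Nat.mul_le_mul_left _ (Nat.add_le_add_left (Nat.mul_le_mul_right _
      (Nat.pow_le_pow_right (by omega) (by omega))) _)
  have hux : ∀ t ∈ I, ∀ j < L, ∀ i b, u t j ≠ t.2.1 i b := by
    intro t ht j hj i b h
    refine ((hu1 t ht).1 j hj).2 (mem_union_left _ ?_)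
    rw [h]; exact hroots t i b
  have hu : ∀ t ∈ I, ∀ j < L, u t j ∉ placed (u t) j := fun t ht j hj h =>
    ((hu1 t ht).1 j hj).2 (mem_union_right _ h)
  have huV : ∀ t ∈ I, ∀ j < L, u t j ∈ G.verts := fun t ht j hj =>
    (mem_filter.1 ((hu1 t ht).1 j hj).1).1
  let θ : ∀ t : GadgetLabel α β, (_ : Fin t.1 → Bool) × ℕ → β → α :=
    fun t => gadgetMap F₀ τ f M t.2.1 t.2.2.1 (u t)
  have hinj : ∀ t ∈ I, ∀ p ∈ gadgetIndex t.1 M, Set.InjOn (θ t p) Fs.verts := by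
    intro t ht p hp
    obtain ⟨-, h2, -, h4⟩ := hIspec t ht
    exact gadgetMap_injOn hM h4 hτ hτf (hQinj _ _ h2) (hL t ht) (hux t ht) (hu t ht) hp
  have hcross : ∀ t ∈ I, ∀ p ∈ gadgetIndex t.1 M, ∀ q ∈ gadgetIndex t.1 M, p ≠ q →
      ∀ v ∈ Fs.verts, ∀ w ∈ Fs.verts, θ t p v = θ t q w → v ∈ F₀.verts := by
    intro t ht p hp q hq hpq v hv w hw h
    obtain ⟨-, -, h3, h4⟩ := hIspec t ht
    exact gadgetMap_cross hM h4 h3 hτ hτf (hL t ht) (hux t ht) (hu t ht) hp hq hpq hv hw h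
  let E : GadgetLabel α β → Finset (Finset α) := fun t =>
    gadgetEdges Fs F₀ (gadgetIndex t.1 M) (θ t)
  let 𝓒 : GadgetLabel α β → Finset (RGraph r α) := fun t =>
    gadgetCopies 𝓕 F₀ (gadgetIndex t.1 M) (θ t)
  have hface : ∀ t ∈ I, ∀ F' ∈ 𝓒 t, ∀ S ⊆ F'.verts, IsFace (rootSets t) (placed (u t) L) S := by
    intro t ht F' hF' S hS
    obtain ⟨-, p, hp, hsub⟩ := isCopy_of_mem_gadgetCopies h𝓕 (hinj t ht) hF'
    exact ⟨_, mem_image_of_mem _ (mem_univ p.1), hS.trans (hsub.trans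
      (image_gadgetMap_subset hM (hIspec t ht).2.2.2 hτf (hL t ht) hp))⟩
  have hcover : ∀ t ∈ I, ∀ e, e ∈ E t ↔ ∃ F' ∈ 𝓒 t, e ∈ F'.edges := fun t ht e =>
    mem_gadgetEdges_iff h𝓕 hF₀ (hinj t ht)
  have hEface : ∀ t ∈ I, ∀ e ∈ E t, IsFace (rootSets t) (placed (u t) L) e := by
    intro t ht e he
    obtain ⟨F', hF', heF'⟩ := (hcover t ht e).1 he
    exact hface t ht F' hF' e (F'.subset_verts e heF')
  have hEG : ∀ t ∈ I, E t ⊆ G.edges := by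
    intro t ht
    obtain ⟨-, h2, h3, h4⟩ := hIspec t ht
    exact gadgetEdges_subset hM h4 h3 hτ hτf (hQinj _ _ h2) (hL t ht) (hux t ht) (hu t ht)
      h𝓕 hsep hF₀ (hQV _ _ h2) (huV t ht) fun j hj => ((hu1 t ht).1 j hj).1
  have hdisj : ∀ t ∈ I, ∀ t' ∈ I, t ≠ t' → Disjoint (E t) (E t') := by
    intro t ht t' ht' hne
    rw [disjoint_left]
    intro e he he'
    have h1 := hu2 t ht t' ht' hne e (hEface t ht e he) (hEface t' ht' e he')
    rw [G.card_eq e (hEG t ht he)] at h1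
    omega
  refine ⟨E, 𝓒, ?_, ?_, hdisj, ?_⟩
  · intro t ht
    obtain ⟨h1, h2, h3, h4⟩ := hIspec t ht
    refine ⟨hEG t ht, ?_, fun e he => (hcover t ht e).1 he, ?_, ?_⟩
    · intro F' hF'
      refine ⟨(isCopy_of_mem_gadgetCopies h𝓕 (hinj t ht) hF').1, ?_, ?_, ?_⟩
      · obtain ⟨B, hB, hsub⟩ := hface t ht F' hF' _ (Subset.refl _)
        refine hsub.trans (union_subset (h𝓑V t ht B hB) fun v hv => ?_)
        obtain ⟨j, hj, rfl⟩ := mem_placed.1 hv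
        exact huV t ht j hj
      · exact fun e he => (hcover t ht e).2 ⟨F', hF', he⟩
      · exact fun S hS hcard => (hu1 t ht).2 S (hface t ht F' hF' S hS) hcard
    · exact divDegree_dvd_degree_gadgetEdges h𝓕 hsep hF₀ (hinj t ht) (hcross t ht)
    · intro S hS
      exact divDegree_dvd_degree_gadget_sub hM h4 h3 hτ hτf (hQinj _ _ h2) (hL t ht) (hux t ht)
        (hu t ht) h𝓕 hsep hF₀ hS (hMdvd _ (by omega))
  · intro t ht t' ht' F₁ hF₁ F₂ hF₂ hne
    by_cases htt : t = t'
    · subst htt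
      exact card_inter_lt_of_mem_gadgetCopies h𝓕 hsep hF₀ (hinj t ht) (hcross t ht) hF₁ hF₂ hne
    · exact hu2 t ht t' ht' htt _ (hface t ht F₁ hF₁ _ inter_subset_left)
        (hface t' ht' F₂ hF₂ _ inter_subset_right)
  · intro S hS
    rw [degree_biUnion I E hdisj]
    calc _ ≤ ∑ t ∈ I, if IsFace (rootSets t) (placed (u t) L) S then N else 0 := by
          refine sum_le_sum fun t ht => ?_
          split_ifs with hSf
          · have h1 : ∀ e ∈ E t, e ⊆ (rootSets t).sup id ∪ placed (u t) L := by
              intro e he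
              obtain ⟨B, hB, hsub⟩ := hEface t ht e he
              exact hsub.trans (union_subset_union_left (le_sup (f := id) hB))
            refine (degree_le_card h1 (fun e he => G.card_eq e (hEG t ht he)) hS).trans ?_
            refine (card_union_le _ _).trans ((Nat.add_le_add_left (card_placed_le _ _) _).trans ?_)
            exact h𝓑card t ht
          · rw [Nat.le_zero]
            exact card_eq_zero.2 (filter_eq_empty_iff.2 fun e he h =>
              hSf ((hEface t ht e he).mono h))
      _ = #{t ∈ I | IsFace (rootSets t) (placed (u t) L) S} * N := by
          rw [← sum_filter, sum_const, smul_eq_mul]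
      _ ≤ 2 * C₀ * lam ^ r * N := Nat.mul_le_mul_right _ (hu3 S hS)
      _ = _ := by ring

end

/-! ### The degree corrector -/

/-- The loss in the greedy placement is less than `ξ * n` if `lam`, `γ⁻¹` and `n` are large, in this
order. -/
lemma greedy_loss_lt {ξ γ : ℝ} {N C₀ lam f r n : ℕ} (hξ : 0 < ξ)
    (hlam : 2 ^ N * (2 * N) * 4 / ξ ≤ lam) (hlam1 : 1 ≤ lam) (hγ : γ ≤ ξ / (4 * 2 ^ N))
    (hr : r ≤ f) (hn1 : 1 ≤ n) (hn : ((N : ℝ) + 2 ^ N * (2 * N * C₀ * lam ^ f)) * 4 / ξ ≤ n) :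
    (N : ℝ) + 2 ^ N * (2 * N * n / lam + γ * n + 2 * N * C₀ * lam ^ r) < ξ * n := by
  have hn0 : (0 : ℝ) < n := by exact_mod_cast hn1
  have hl0 : (0 : ℝ) < lam := by exact_mod_cast hlam1
  have h1 : (2 : ℝ) ^ N * (2 * N * n / lam) ≤ ξ / 4 * n := by
    rw [div_le_iff₀ hξ] at hlam
    rw [← mul_div_assoc, div_le_iff₀ hl0]
    nlinarith
  have h2 : (2 : ℝ) ^ N * (γ * n) ≤ ξ / 4 * n := by
    have h : (0 : ℝ) < 4 * 2 ^ N := by positivity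
    rw [le_div_iff₀ h] at hγ
    nlinarith
  have h3 : (2 * N * C₀ * lam ^ r : ℝ) ≤ 2 * N * C₀ * lam ^ f := by
    have : (1 : ℝ) ≤ lam := by exact_mod_cast hlam1
    gcongr
  have h4 : (2 : ℝ) ^ N * (2 * N * C₀ * lam ^ r) ≤ 2 ^ N * (2 * N * C₀ * lam ^ f) := by gcongr
  have h5 : (N : ℝ) + 2 ^ N * (2 * N * C₀ * lam ^ f) ≤ ξ / 4 * n := by
    rw [div_le_iff₀ hξ] at hn
    linarith
  have h6 : 0 < ξ * n := mul_pos hξ hn0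
  linarith

lemma card_insert_mem_le_maxDegree {α : Type*} [DecidableEq α] {r : ℕ} (O : RGraph (r + 1) α)
    {T : Finset α} (hT : T ⊆ O.verts) (hTr : T.card = r) :
    #{v ∈ O.verts | insert v T ∈ O.edges} ≤ O.maxDegree := by
  have h1 : (O.link T).card ≤ O.maxDegree :=
    le_sup (f := fun S => (O.link S).card) (mem_powersetCard.2 ⟨hT, hTr⟩)
  refine le_trans ?_ h1
  refine card_le_card_of_injOn (fun v => {v}) ?_ fun v _ w _ h => by simpa using h
  intro v hv
  obtain ⟨hv, hvT⟩ := mem_filter.1 hv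
  have hvT' : v ∉ T := by
    intro h
    have := O.card_eq _ hvT
    rw [insert_eq_of_mem h] at this
    omega
  refine mem_filter.2 ⟨mem_powerset.2 ?_, ?_⟩
  · exact singleton_subset_iff.2 (mem_sdiff.2 ⟨hv, hvT'⟩)
  · rwa [union_comm, ← insert_eq]

theorem mainTheorem9 :
    ∀ ξ : ℝ, 0 < ξ → ξ ≤ 1 → ∀ fstar : ℕ, 1 ≤ fstar →
    ∃ γ₀ : ℝ, 0 < γ₀ ∧ γ₀ < 1 ∧ ∀ γ : ℝ, 0 < γ → γ ≤ γ₀ →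
    ∃ n₀ : ℕ, ∀ n : ℕ, n₀ ≤ n →
    ∀ r : ℕ, 1 ≤ r → r ≤ fstar - 1 →
    ∀ {α β β' : Type*} [DecidableEq α] [DecidableEq β] [DecidableEq β']
      (F : RGraph r β) (Fstar : RGraph r β') (G : RGraph r α) (O : RGraph (r + 1) α),
      F.edges.Nonempty → Fstar.edges.Nonempty → Fstar.verts.card = fstar →
      (∃ 𝓕 : Finset (RGraph r β'),
        RGraph.IsDecomposition F Fstar 𝓕 ∧ RGraph.IsWellSeparated 1 𝓕) →
      G.verts.card = n →
      (∀ A : Finset (Finset α), A ⊆ G.verts.powersetCard (r - 1) →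
        A.card ≤ (fstar - 1).choose (r - 1) → ξ * (n : ℝ) ≤ ((G.commonNeighbors A).card : ℝ)) →
      O.verts = G.verts → (O.maxDegree : ℝ) ≤ γ * (n : ℝ) →
      ∃ D : RGraph r α, D.IsSubgraph G ∧ RGraph.IsDivisible F D ∧
        (D.maxDegree : ℝ) ≤ γ ^ (-2 : ℤ) ∧
        ∀ H : RGraph r α, H.verts = G.verts → RGraph.IsDivisible F H →
          Disjoint H.edges D.edges →
          ∃ Dstar : RGraph r α, Dstar.IsSubgraph D ∧
            RGraph.IsDivisible Fstar (H.union Dstar) ∧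
            ∃ 𝓕 : Finset (RGraph r α),
              RGraph.IsDecomposition F (D.deleteEdges Dstar) 𝓕 ∧
              RGraph.IsWellSeparated 1 𝓕 ∧
              Disjoint (RGraph.generatedLevel 𝓕 (r + 1)) O.edges := by
  intro ξ hξ hξ1 f hf
  choose C hC using fun k => exists_octahedra k
  -- `M` is a common multiple of all possible entries of `Deg(Fstar)`, as these are at most `2 ^ f`
  obtain ⟨M, hMdef⟩ : ∃ M, M = (2 ^ f).factorial := ⟨_, rfl⟩
  -- `N` bounds the number of vertices of a gadget
  obtain ⟨N, hN⟩ : ∃ N, N = 2 * f + f * (1 + 2 ^ f * M) := ⟨_, rfl⟩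
  obtain ⟨C₀, hC₀⟩ : ∃ C₀, C₀ = (∑ k ∈ range f, C k) * (f ^ f * M) + 1 := ⟨_, rfl⟩
  obtain ⟨lam, hlam⟩ : ∃ lam, lam = ⌈(2 : ℝ) ^ N * (2 * N) * 4 / ξ⌉₊ + 1 := ⟨_, rfl⟩
  have hM : 1 ≤ M := hMdef ▸ Nat.factorial_pos _
  have hlam1 : 1 ≤ lam := by omega
  have hlam2 : (2 : ℝ) ^ N * (2 * N) * 4 / ξ ≤ lam := by
    rw [hlam]; push_cast
    exact (Nat.le_ceil _).trans (by linarith)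
  have hK : (0 : ℝ) < N * (2 * C₀ * lam ^ f) + 1 := by positivity
  -- the second term leaves room for `O`, the third makes `γ⁻²` exceed the maximum degree of `D`
  refine ⟨min (1 / 2) (min (ξ / (4 * 2 ^ N)) (1 / (N * (2 * C₀ * lam ^ f) + 1))), ?_, ?_, ?_⟩
  · exact lt_min (by norm_num) (lt_min (by positivity) (by positivity))
  · exact (min_le_left _ _).trans_lt (by norm_num)
  intro γ hγ hγ₀
  have hγ1 : γ ≤ 1 := (hγ₀.trans (min_le_left _ _)).trans (by norm_num)
  have hγ2 : γ ≤ ξ / (4 * 2 ^ N) := hγ₀.trans ((min_le_right _ _).trans (min_le_left _ _))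
  have hγ3 : (N * (2 * C₀ * lam ^ f) : ℝ) ≤ γ ^ (-2 : ℤ) := by
    have h1 : γ ≤ 1 / (N * (2 * C₀ * lam ^ f) + 1) :=
      hγ₀.trans ((min_le_right _ _).trans (min_le_right _ _))
    rw [le_div_iff₀ hK] at h1
    have h2 : (N * (2 * C₀ * lam ^ f) : ℝ) + 1 ≤ 1 / γ := by
      rw [le_div_iff₀ hγ]; linarith
    have h3 : 1 / γ ≤ γ ^ (-2 : ℤ) := by
      rw [zpow_neg, ← one_div, div_le_div_iff₀ hγ (by positivity)]
      norm_cast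
      nlinarith
    linarith
  refine ⟨⌈((N : ℝ) + 2 ^ N * (2 * N * C₀ * lam ^ f)) * 4 / ξ⌉₊ + 1, ?_⟩
  intro n hn r hr hrf α β β' _ _ _ F Fs G O hF hFs hFsf ⟨𝓕, h𝓕, hsep⟩ hGn hG hOG hO
  have hn1 : 1 ≤ n := by omega
  have hn2 : ((N : ℝ) + 2 ^ N * (2 * N * C₀ * lam ^ f)) * 4 / ξ ≤ n :=
    (Nat.le_ceil _).trans (by exact_mod_cast (Nat.le_succ _).trans hn)
  have hV : G.verts.Nonempty := card_pos.1 (by omega)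
  obtain ⟨e₀, he₀⟩ := hFs
  obtain ⟨F₀, hF₀, -⟩ := h𝓕.2 e₀ he₀
  choose Q hQ1 hQ2 hQ3 using fun k => hC k G.verts
  have hdeg : ∀ i ≤ r, 0 < Fs.divDegree i ∧ Fs.divDegree i ≤ 2 ^ f := fun i hi => by
    have := RGraph.divDegree_pos ⟨e₀, he₀⟩ hi
    rwa [hFsf] at this
  have hdvd : ∀ i ≤ r, Fs.divDegree i ∣ M := fun i hi => by
    rw [hMdef]; exact Nat.dvd_factorial (hdeg i hi).1 (hdeg i hi).2
  obtain ⟨E, 𝓒, hE, hsepC, hdisjE, hEdeg⟩ := exists_gadgets (c := ξ * n) (γ := γ * n) (N := N)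
    (C₀ := C₀) (lam := lam) hr (by omega) hM hlam1 hV (by positivity) hFsf hdvd h𝓕 hsep hF₀ hG
    (fun T hT hTr => by
      rw [← hOG] at hT ⊢
      exact (Nat.cast_le.2 (card_insert_mem_le_maxDegree O hT hTr)).trans hO)
    (fun k x hx => (hQ1 k x hx).2) (fun k x hx => (hQ1 k x hx).1) hQ2 hC₀ hN (by
      rw [hGn]
      exact greedy_loss_lt hξ hlam2 hlam1 hγ2 (by omega) hn1 hn2)
  set I := gadgetFamily Q F₀.verts r M with hI
  have hEG : ∀ t ∈ I, E t ⊆ G.edges := fun t ht => (hE t ht).1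
  -- the union of the gadgets in `J`; it is a graph on `V(G)` as all gadgets lie in `G`
  let U : Finset _ → RGraph r α := fun J =>
    { verts := G.verts
      edges := {e ∈ G.edges | e ∈ J.biUnion E}
      subset_verts := fun e he => G.subset_verts e (mem_filter.1 he).1
      card_eq := fun e he => G.card_eq e (mem_filter.1 he).1 }
  have hU : ∀ J ⊆ I, (U J).edges = J.biUnion E := by
    intro J hJ
    ext e
    simp only [U, mem_filter, and_iff_right_iff_imp]
    intro he
    obtain ⟨t, ht, he⟩ := mem_biUnion.1 he
    exact hEG t (hJ ht) he
  have hUdeg : ∀ J ⊆ I, ∀ S, degree (U J).edges S = ∑ t ∈ J, degree (E t) S := by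
    intro J hJ S
    rw [hU J hJ, degree_biUnion]
    exact fun t ht t' ht' => hdisjE t (hJ ht) t' (hJ ht')
  refine ⟨U I, ⟨Subset.refl _, filter_subset _ _⟩, ?_, ?_, ?_⟩
  · intro i hi S hS
    obtain ⟨-, rfl⟩ := mem_powersetCard.1 hS
    rw [RGraph.card_link, hUdeg I (Subset.refl _)]
    exact dvd_sum fun t ht => (hE t ht).2.2.2.1 S
  · refine le_trans ?_ hγ3
    have h1 : (U I).maxDegree ≤ N * (2 * C₀ * lam ^ f) := by
      refine Finset.sup_le fun S hS => ?_
      rw [RGraph.card_link, hU I (Subset.refl _)]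
      refine (hEdeg S (by rw [(mem_powersetCard.1 hS).2]; omega)).trans ?_
      exact Nat.mul_le_mul_left _ (Nat.mul_le_mul_left _ (Nat.pow_le_pow_right hlam1 (by omega)))
    exact_mod_cast h1
  intro H hHG hHdiv hHD
  -- `D` is the union of all gadgets, and `Dstar` is that of the gadgets in `J`
  obtain ⟨J, hJ, hJdiv⟩ := exists_selection (V := G.verts) (r := r) (M := M)
    (m := Fs.divDegree) (d := F.divDegree) Q F₀.verts
    (fun k s => (degree F₀.edges (univ.image s) : ℤ)) (fun k x hx => (hQ1 k x hx).1) hQ3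
    (fun k hk => ⟨(hdeg k hk.le).1, Nat.le_of_dvd hM (hdvd k hk.le)⟩)
    (fun i k hik => Fs.divDegree_dvd_choose_mul hik)
    (fun k hk => F₀.exists_divDegree_eq_sum ((h𝓕.1.1 F₀ hF₀).1.divDegree_dvd k))
    (fun S => degree H.edges S) (fun t S => degree (E t) S)
    (fun k T hT => sum_degree_superset (by rw [← hHG]; exact H.subset_verts) H.card_eq hT)
    (fun t ht k T hT => sum_degree_superset (fun e he => G.subset_verts e (hEG t ht he))
      (fun e he => G.card_eq e (hEG t ht he)) hT)
    (fun S hS hSr => by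
      rw [← H.card_link]
      exact hHdiv _ hSr S (mem_powersetCard.2 ⟨by rw [hHG]; exact hS, rfl⟩))
    (fun t ht => (hE t ht).2.2.2.1) (fun t ht => (hE t ht).2.2.2.2)
  have hUJ : (U J).edges ⊆ (U I).edges := by
    rw [hU J hJ, hU I (Subset.refl _)]
    exact biUnion_subset_biUnion_of_subset_left _ hJ
  refine ⟨U J, ⟨Subset.refl _, hUJ⟩, ?_, ?_⟩
  · intro i hi S hS
    obtain ⟨hSV, rfl⟩ := mem_powersetCard.1 hS
    have hSG : S ⊆ G.verts := hSV.trans (union_subset hHG.subset (Subset.refl _))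
    rw [RGraph.card_link]
    change _ ∣ degree (H.edges ∪ (U J).edges) S
    rw [degree_union (hHD.mono_right hUJ), hUdeg J hJ]
    exact hJdiv S hSG hi
  classical
  -- the copies of `F` in the gadgets that were not selected
  let 𝓗 : Finset (RGraph r α) := (I \ J).biUnion 𝓒
  have h𝓗 : ∀ F' ∈ 𝓗, ∃ t ∈ I, t ∉ J ∧ F' ∈ 𝓒 t := by
    intro F' hF'
    obtain ⟨t, ht, hF'⟩ := mem_biUnion.1 hF'
    exact ⟨t, (mem_sdiff.1 ht).1, (mem_sdiff.1 ht).2, hF'⟩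
  have hinter : ∀ F₁ ∈ 𝓗, ∀ F₂ ∈ 𝓗, F₁ ≠ F₂ → (F₁.verts ∩ F₂.verts).card < r := by
    intro F₁ h₁ F₂ h₂ hne
    obtain ⟨t₁, ht₁, -, h₁⟩ := h𝓗 F₁ h₁
    obtain ⟨t₂, ht₂, -, h₂⟩ := h𝓗 F₂ h₂
    exact hsepC t₁ ht₁ t₂ ht₂ F₁ h₁ F₂ h₂ hne
  refine ⟨𝓗, ⟨⟨?_, ?_⟩, ?_⟩, RGraph.isWellSeparated_one hinter, ?_⟩
  · intro F' hF'
    obtain ⟨t, ht, htJ, hF'⟩ := h𝓗 F' hF'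
    obtain ⟨h1, h2, h3, -⟩ := (hE t ht).2.1 F' hF'
    refine ⟨h1, h2, fun e he => mem_sdiff.2 ⟨?_, ?_⟩⟩
    · rw [hU I (Subset.refl _)]
      exact mem_biUnion.2 ⟨t, ht, h3 he⟩
    · rw [hU J hJ]
      intro he'
      obtain ⟨t', ht', he'⟩ := mem_biUnion.1 he'
      refine disjoint_left.1 (hdisjE t ht t' (hJ ht') ?_) (h3 he) he'
      rintro rfl
      exact htJ ht'
  · exact fun F₁ h₁ F₂ h₂ hne => RGraph.disjoint_edges_of_card_inter_lt (hinter F₁ h₁ F₂ h₂ hne)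
  · intro e he
    obtain ⟨he, heJ⟩ := mem_sdiff.1 he
    rw [hU I (Subset.refl _)] at he
    rw [hU J hJ] at heJ
    obtain ⟨t, ht, he⟩ := mem_biUnion.1 he
    obtain ⟨F', hF', heF'⟩ := (hE t ht).2.2.1 e he
    refine ⟨F', mem_biUnion.2 ⟨t, mem_sdiff.2 ⟨ht, fun htJ => heJ ?_⟩, hF'⟩, heF'⟩
    exact mem_biUnion.2 ⟨t, htJ, he⟩
  · rw [disjoint_left]
    intro S hS hSO
    obtain ⟨F', hF', hS⟩ := mem_biUnion.1 hS
    obtain ⟨t, ht, -, hF'⟩ := h𝓗 F' hF'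
    obtain ⟨hSV, hScard⟩ := mem_powersetCard.1 hS
    exact ((hE t ht).2.1 F' hF').2.2.2 S hSV hScard hSO
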